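/- Let $n \ge 2$, let $G = \mathrm{SL}_n(\mathbb{R})$, $K = \mathrm{SO}(n)$, and let $X_n = G/K$ be the associated symmetric space. Let $X_{n-1}\times\mathbb{R} \subset X_n$ be the totally geodesic submanifold given by the orbit of the base point $eK$ under the block diagonal subgroup $$\left\{\begin{pmatrix} t^{-1/(n-1)}A & 0\\ 0 & t\end{pmatrix} : A \in \mathrm{SL}_{n-1}(\mathbb{R}),\ t > 0\right\} \cong \mathrm{SL}_{n-1}(\mathbb{R})\times\mathbb{R}.$$ Let $\Gamma < G$ be any cocompact lattice, let $k = \dim X_n - \operatorname{rank} X_n$, and let $\eta$ be any $G$-invariant smooth differential $k$-form on $X_n$. Let $\alpha \in H_k(\Gamma\backslash X_n;\mathbb{R})$ be any class represented by a totally geodesic submanifold covered by $X_{n-1}\times\mathbb{R}$, that is, $\alpha$ is the class of a cycle carried by the image in $\Gamma\backslash X_n$ of a translate $g\,(X_{n-1}\times\mathbb{R})$, $g\in G$ (for instance the fundamental cycle of a closed oriented submanifold covered by such a translate). Then $$\int_\alpha \eta = 0 ,$$ i.e. the integral of $\eta$ over every smooth singular cycle representing $\alpha$ vanishes. Here $H_*(\Gamma\backslash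 X_n;\mathbb{R})$ is computed by the complex of $\Gamma$-coinvariants of the real smooth singular chains of $X_n$, which for torsion-free $\Gamma$ is the complex of smooth singular chains of the manifold $\Gamma\backslash X_n$. -/

import Mathlib

open scoped Matrix ContDiff

noncomputable section

namespace SLSym

/-! ### The symmetric space `X_n = SL_n(ℝ) / SO(n)` -/

/-- The symmetric space `X_n = SL_n(ℝ) / SO(n)`, in its standard model as the closed submanifold of
`Mat_n(ℝ)` of positive definite symmetric matrices of determinant one; the coset `g SO(n)`
is the matrix `g gᵀ`. -/
def Space (n : ℕ) : Type :=
  {P : Matrix (Fin n) (Fin n) ℝ // P.PosDef ∧ P.det = 1}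

/-- The point of `X_n` that corresponds to the coset of the identity. -/
def basePoint (n : ℕ) : Space n := ⟨1, Matrix.PosDef.one, Matrix.det_one⟩

theorem act_mem {n : ℕ} (g : Matrix.SpecialLinearGroup (Fin n) ℝ) (P : Space n) :
    (g.1 * P.1 * g.1ᵀ).PosDef ∧ (g.1 * P.1 * g.1ᵀ).det = 1 := by
  refine ⟨?_, by simp [Matrix.det_mul, P.2.2]⟩
  have hg : IsUnit g.1 := (Matrix.isUnit_iff_isUnit_det _).2 (by simp)
  have h := P.2.1.mul_mul_conjTranspose_same (B := g.1)
    (Matrix.vecMul_injective_of_isUnit hg)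
  simpa [Matrix.conjTranspose_eq_transpose_of_trivial] using h

/-- `SL_n(ℝ)` acts on `X_n` by `g • P = g P gᵀ`, which is left translation of cosets. -/
instance instMulAction (n : ℕ) : MulAction (Matrix.SpecialLinearGroup (Fin n) ℝ) (Space n) where
  smul g P := ⟨g.1 * P.1 * g.1ᵀ, act_mem g P⟩
  one_smul P := by
    apply Subtype.ext
    change (1 : Matrix.SpecialLinearGroup (Fin n) ℝ).1 * P.1 *
      (1 : Matrix.SpecialLinearGroup (Fin n) ℝ).1ᵀ = P.1
    simp
  mul_smul g h P := by
    apply Subtype.ext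
    change (g * h).1 * P.1 * (g * h).1ᵀ = g.1 * (h.1 * P.1 * h.1ᵀ) * g.1ᵀ
    simp [Matrix.mul_assoc]

theorem coe_smul {n : ℕ} (g : Matrix.SpecialLinearGroup (Fin n) ℝ) (P : Space n) :
    (g • P).1 = g.1 * P.1 * g.1ᵀ := rfl

/-- The tangent space of `X_n` at `P`, inside `Mat_n(ℝ)`: the symmetric matrices `V` with
`tr (P⁻¹ V) = 0`. -/
def tangent {n : ℕ} (P : Space n) : Submodule ℝ (Matrix (Fin n) (Fin n) ℝ) where
  carrier := {V | V.IsSymm ∧ (P.1⁻¹ * V).trace = 0}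
  add_mem' := by
    rintro V W ⟨hV, hV'⟩ ⟨hW, hW'⟩
    exact ⟨hV.add hW, by simp [Matrix.mul_add, hV', hW']⟩
  zero_mem' := ⟨Matrix.isSymm_zero, by simp⟩
  smul_mem' := by
    rintro c V ⟨hV, hV'⟩
    exact ⟨hV.smul c, by simp [hV']⟩

/-! ### Invariant differential forms -/

/-- A smooth differential `k`-form on `X_n`, given as the restriction of a smooth `k`-form on
`Mat_n(ℝ)` (every smooth form on a closed submanifold is such a restriction). Only the values
at points of `X_n` on tangent vectors of `X_n` are ever used. Smoothness says that the values on
constant vectors are smooth functions of the matrix entries. -/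
structure DiffForm (n k : ℕ) where
  toFun : Matrix (Fin n) (Fin n) ℝ → Matrix (Fin n) (Fin n) ℝ [⋀^Fin k]→ₗ[ℝ] ℝ
  smooth : ∀ v : Fin k → Matrix (Fin n) (Fin n) ℝ,
    ContDiff ℝ ∞ fun A : Fin n → Fin n → ℝ => toFun (Matrix.of A) v

/-- The form on `X_n` is `SL_n(ℝ)`-invariant: `g^* η = η` for all `g`. The derivative of
`P ↦ g P gᵀ` is `V ↦ g V gᵀ`. -/
def DiffForm.IsInvariant {n k : ℕ} (η : DiffForm n k) : Prop :=
  ∀ (g : Matrix.SpecialLinearGroup (Fin n) ℝ) (P : Space n)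
    (v : Fin k → Matrix (Fin n) (Fin n) ℝ), (∀ i, v i ∈ tangent P) →
      η.toFun (g • P).1 (fun i => g.1 * v i * g.1ᵀ) = η.toFun P.1 v

/-! ### Smooth singular chains -/

/-- A smooth singular `k`-simplex of `X_n`: a map from the standard simplex
`{t ∈ ℝ^{k+1} | t_i ≥ 0, ∑ t_i = 1}` to `X_n` that is the restriction of a smooth map from
`ℝ^{k+1}` to `Mat_n(ℝ)` (smoothness is smoothness of the matrix entries). -/
@[ext]
structure SmoothSimplex (n k : ℕ) where
  toFun : stdSimplex ℝ (Fin (k + 1)) → Space n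
  smooth : ∃ F : (Fin (k + 1) → ℝ) → Matrix (Fin n) (Fin n) ℝ,
    (∀ a b, ContDiff ℝ ∞ fun t => F t a b) ∧ ∀ t, F t.1 = (toFun t).1

/-- The `i`-th face of a smooth simplex. -/
def SmoothSimplex.face {n k : ℕ} (i : Fin (k + 2)) (σ : SmoothSimplex n (k + 1)) :
    SmoothSimplex n k where
  toFun t := σ.toFun (stdSimplex.map i.succAbove t)
  smooth := by
    obtain ⟨F, hF, h⟩ := σ.smooth
    refine ⟨fun t => F (FunOnFinite.linearMap ℝ ℝ i.succAbove t), fun a b => ?_, fun t => ?_⟩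
    · exact (hF a b).comp
        (LinearMap.toContinuousLinearMap (FunOnFinite.linearMap ℝ ℝ i.succAbove)).contDiff
    · exact h (stdSimplex.map i.succAbove t)

/-- The translate of a smooth simplex by an element of `SL_n(ℝ)`. -/
def SmoothSimplex.translate {n k : ℕ} (g : Matrix.SpecialLinearGroup (Fin n) ℝ)
    (σ : SmoothSimplex n k) : SmoothSimplex n k where
  toFun t := g • σ.toFun t
  smooth := by
    obtain ⟨F, hF, h⟩ := σ.smooth
    refine ⟨fun t => g.1 * F t * g.1ᵀ, fun a b => ?_, fun t => ?_⟩
    · simp only [Matrix.mul_apply]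
      fun_prop
    · have h' := h t
      change g.1 * F t.1 * g.1ᵀ = g.1 * (σ.toFun t).1 * g.1ᵀ
      rw [h']

/-- Smooth singular `k`-chains of `X_n` with real coefficients. -/
abbrev Chain (n k : ℕ) : Type := SmoothSimplex n k →₀ ℝ

/-- The singular boundary operator `∂ σ = ∑ i, (-1)^i face_i σ`. -/
def boundary (n : ℕ) : (k : ℕ) → Chain n k →ₗ[ℝ] Chain n (k - 1)
  | 0 => 0
  | k + 1 => Finsupp.linearCombination ℝ fun σ =>
      ∑ i : Fin (k + 2), Finsupp.single (σ.face i) ((-1 : ℝ) ^ (i : ℕ))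

/-! ### The homology of `Γ \ X_n` -/

/-- The chains that vanish in the quotient by `Γ`: the span of all `γ σ - σ` with `γ ∈ Γ`. -/
def translationChains {n : ℕ} (Γ : Subgroup (Matrix.SpecialLinearGroup (Fin n) ℝ)) (k : ℕ) :
    Submodule ℝ (Chain n k) :=
  Submodule.span ℝ {c | ∃ γ ∈ Γ, ∃ σ : SmoothSimplex n k,
    c = Finsupp.single (σ.translate γ) 1 - Finsupp.single σ 1}

/-- The `k`-cycles of `Γ \ X_n`: chains of `X_n` whose boundary vanishes in the quotient. -/
def cycles {n : ℕ} (Γ : Subgroup (Matrix.SpecialLinearGroup (Fin n) ℝ)) (k : ℕ) :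
    Submodule ℝ (Chain n k) :=
  (translationChains Γ (k - 1)).comap (boundary n k)

/-- The `k`-boundaries of `Γ \ X_n`: chains of `X_n` that are a boundary in the quotient. -/
def boundaries {n : ℕ} (Γ : Subgroup (Matrix.SpecialLinearGroup (Fin n) ℝ)) (k : ℕ) :
    Submodule ℝ (Chain n k) :=
  LinearMap.range (boundary n (k + 1)) ⊔ translationChains Γ k

/-- The homology `H_k(Γ \ X_n; ℝ)`: the homology of the complex of `Γ`-coinvariants of the smooth
singular chains of `X_n`, as the image of the cycles in chains modulo boundaries. If `Γ` is discrete and torsion-free, this complex is the complex of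
smooth singular chains of the manifold `Γ \ X_n` (each simplex lifts to `X_n`, uniquely up
to `Γ`). For a discrete `Γ` with torsion its homology is still the real homology of
`Γ \ X_n` and of the group `Γ`, and it is the one on which `Γ`-invariant forms are integrated. -/
def Homology {n : ℕ} (Γ : Subgroup (Matrix.SpecialLinearGroup (Fin n) ℝ)) (k : ℕ) :
    Submodule ℝ (Chain n k ⧸ boundaries Γ k) :=
  (cycles Γ k).map (boundaries Γ k).mkQ

/-- The homology class of a cycle. -/
def homologyClass {n k : ℕ} {Γ : Subgroup (Matrix.SpecialLinearGroup (Fin n) ℝ)}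
    (z : cycles Γ k) : Homology Γ k :=
  ⟨(boundaries Γ k).mkQ z.1, Submodule.mem_map_of_mem z.2⟩

/-! ### Integration of forms over chains -/

/-- The affine coordinates `(s_1, …, s_k) ↦ (1 - ∑ s_i, s_1, …, s_k)` of the standard simplex. -/
def baryCoord {k : ℕ} (s : Fin k → ℝ) : Fin (k + 1) → ℝ :=
  Fin.cons (1 - ∑ i, s i) s

/-- The standard simplex in affine coordinates: `s_i ≥ 0`, `∑ s_i ≤ 1`. -/
def cornerSimplex (k : ℕ) : Set (Fin k → ℝ) :=
  {s | baryCoord s ∈ stdSimplex ℝ (Fin (k + 1))}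

open Classical in
/-- A smooth simplex in affine coordinates (extended by zero outside of `cornerSimplex k`). -/
def SmoothSimplex.param {n k : ℕ} (σ : SmoothSimplex n k) (s : Fin k → ℝ) :
    Matrix (Fin n) (Fin n) ℝ :=
  if h : baryCoord s ∈ stdSimplex ℝ (Fin (k + 1)) then (σ.toFun ⟨baryCoord s, h⟩).1 else 0

/-- The partial derivative `∂σ/∂s_i` of a smooth simplex, entry by entry. -/
def SmoothSimplex.partialDeriv {n k : ℕ} (σ : SmoothSimplex n k) (s : Fin k → ℝ) (i : Fin k) :
    Matrix (Fin n) (Fin n) ℝ :=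
  Matrix.of fun a b =>
    fderivWithin ℝ (fun s' => σ.param s' a b) (cornerSimplex k) s (Pi.single i 1)

/-- The integral `∫_σ η = ∫ η_{σ(s)}(∂σ/∂s_1, …, ∂σ/∂s_k) ds` over the standard simplex. -/
def simplexIntegral {n k : ℕ} (η : DiffForm n k) (σ : SmoothSimplex n k) : ℝ :=
  ∫ s in cornerSimplex k, η.toFun (σ.param s) (σ.partialDeriv s)

/-- The integral of a form over a chain. -/
def chainIntegral {n k : ℕ} (η : DiffForm n k) : Chain n k →ₗ[ℝ] ℝ :=
  Finsupp.linearCombination ℝ (simplexIntegral η)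

/-! ### Cocompact lattices and the submanifold `X_{n-1} × ℝ` -/

/-- `Γ` is a cocompact lattice: a discrete subgroup of `SL_n(ℝ)` with compact quotient. -/
def IsCocompactLattice {n : ℕ} (Γ : Subgroup (Matrix.SpecialLinearGroup (Fin n) ℝ)) : Prop :=
  DiscreteTopology Γ ∧ CompactSpace (Matrix.SpecialLinearGroup (Fin n) ℝ ⧸ Γ)

/-- `b` lies in the block diagonal subgroup `SL_{n-1}(ℝ) × ℝ`: it has blocks of size `n - 1`
and `1`, and its last diagonal entry `t` is positive. (As `det b = 1`, the upper block
is then `t^{-1/(n-1)}` times an element of `SL_{n-1}(ℝ)`.) -/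
def IsBlock {n : ℕ} (b : Matrix.SpecialLinearGroup (Fin n) ℝ) : Prop :=
  (∀ i j : Fin n, ¬ ((i : ℕ) + 1 = n ↔ (j : ℕ) + 1 = n) → b.1 i j = 0) ∧
    ∀ i : Fin n, (i : ℕ) + 1 = n → 0 < b.1 i i

/-- The totally geodesic submanifold `X_{n-1} × ℝ` of `X_n`: the orbit of the base point under the
block diagonal subgroup `SL_{n-1}(ℝ) × ℝ`. -/
def blockSubspace (n : ℕ) : Set (Space n) :=
  {P | ∃ b : Matrix.SpecialLinearGroup (Fin n) ℝ, IsBlock b ∧ P = b • basePoint n}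

/-- `N` is a totally geodesic copy of `X_{n-1} × ℝ` in `X_n`, that is, a translate of
`blockSubspace n` by an element of `SL_n(ℝ)`. -/
def IsGeodesicCopy {n : ℕ} (N : Set (Space n)) : Prop :=
  ∃ g : Matrix.SpecialLinearGroup (Fin n) ℝ, N = (fun P => g • P) '' blockSubspace n

/-- `α` is represented by the submanifold of `Γ \ X_n` that is covered by `N ⊆ X_n`: it is the class
of a cycle of `Γ \ X_n` all of whose simplices lie in this submanifold, i.e. lift to `N`. For
a closed oriented submanifold of dimension `k` this includes its fundamental class. -/
def IsRepresentedBy {n k : ℕ} {Γ : Subgroup (Matrix.SpecialLinearGroup (Fin n) ℝ)}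
    (α : Homology Γ k) (N : Set (Space n)) : Prop :=
  ∃ z : cycles Γ k, (∀ σ ∈ z.1.support, ∀ t, σ.toFun t ∈ N) ∧ homologyClass z = α

/-! ### The degree -/

/-- The dimension of `X_n`, as the dimension of its tangent space at the base point. -/
def dimX (n : ℕ) : ℕ := Module.finrank ℝ (tangent (basePoint n))

/-- The rank of `X_n`: the largest dimension of a maximal flat through the base point, that is, of an
abelian subspace of the tangent space `𝔭` of trace-free symmetric matrices. -/
def rankX (n : ℕ) : ℕ :=
  sSup {d | ∃ A : Submodule ℝ (Matrix (Fin n) (Fin n) ℝ), A ≤ tangent (basePoint n) ∧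
    (∀ V ∈ A, ∀ W ∈ A, V * W = W * V) ∧ Module.finrank ℝ A = d}

end SLSym

end

/-!
An invariant form `η` on the symmetric space `X_n` is closed, by Cartan's argument with the geodesic
symmetries (`DiffForm.IsInvariant.extDeriv_pullback_eq_zero`). By Stokes' theorem on the standard
simplex (`setIntegral_extDeriv_cornerSimplex`) its integral vanishes on boundaries, and by
invariance it vanishes on the chains `γ σ - σ`. So `∫_α η` depends only on the class `α`, and may be
computed on a cycle whose simplices lie in a translate of `X_{n-1} × ℝ`, which can be moved to
`X_{n-1} × ℝ` itself.

There the integrand vanishes identically. By homogeneity this is a statement about the value of `η`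
at the base point, an `SO(n)`-invariant alternating form `T` on the trace-free symmetric matrices.
The tangent space of `X_{n-1} × ℝ` is spanned by `H = diag(1, …, 1, 1 - n)` and the trace-free
symmetric matrices `w` whose last row and column vanish, and the degree of `T` exceeds the dimension
of the space of the latter (`rankX_lt`, `finrank_blockTangent_add_le`). So it suffices that `T(H,
w_1, …, w_q) = 0` (`map_axis_eq_zero`). This follows from the infinitesimal invariance of `T` under
the rotations `R_a = E_{an} - E_{na}`, applied to `(S_a, w_1, …, w_q)` with `S_a = E_{an} + E_{na}`
and summed over `a < n`: the commutators `[R_a, S_a]` add up to `2H`, and the commutators `[R_a, w]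
= -∑_b w_{ab} S_b` contribute nothing, since `w` is symmetric and `T` is alternating.
-/

/-! ### Simultaneous diagonalisation and the rank -/

noncomputable section

namespace SLSym

open Module Module.End in
/-- A space of trace-free, pairwise commuting symmetric matrices of size `n` has dimension less than
`n`: in a basis of joint eigenvectors it embeds into the diagonal matrices, and the trace singles
out a proper subspace of these. -/
theorem finrank_lt_of_commute_of_trace_eq_zero {n : ℕ} (hn : 0 < n)
    (A : Submodule ℝ (Matrix (Fin n) (Fin n) ℝ))
    (hsymm : ∀ V ∈ A, V.IsSymm) (htr : ∀ V ∈ A, V.trace = 0)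
    (hcomm : ∀ V ∈ A, ∀ W ∈ A, V * W = W * V) : finrank ℝ A < n := by
  let E := EuclideanSpace ℝ (Fin n)
  let T : A → E →ₗ[ℝ] E := fun V => Matrix.toEuclideanLin V.1
  have hT : ∀ V, (T V).IsSymmetric := fun V => by
    refine Matrix.isSymmetric_toEuclideanLin_iff.2 ?_
    rw [Matrix.IsHermitian, Matrix.conjTranspose_eq_transpose_of_trivial]
    exact hsymm V.1 V.2
  have hC : Pairwise (Function.onFun Commute T) := fun V W _ => by
    change T V * T W = T W * T V
    have h := hcomm V.1 V.2 W.1 W.2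
    simp only [T]
    have hmul : ∀ P Q : Matrix (Fin n) (Fin n) ℝ,
        Matrix.toEuclideanLin P * Matrix.toEuclideanLin Q = Matrix.toEuclideanLin (P * Q) :=
      fun P Q => (Matrix.toLpLin_mul_same _ _ _).symm
    rw [hmul, hmul, h]
  have htop := LinearMap.IsSymmetric.iSup_iInf_eq_top_of_commute hT hC
  -- The joint eigenvectors span, so a basis can be extracted from them.
  let S : Set E := {v | ∀ V, ∃ c : ℝ, T V v = c • v}
  have hS : Submodule.span ℝ S = ⊤ := by
    rw [eq_top_iff, ← htop]
    refine iSup_le fun χ v hv => Submodule.subset_span fun V => ⟨χ V, ?_⟩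
    exact mem_eigenspace_iff.1 ((Submodule.mem_iInf _).1 hv V)
  obtain ⟨b, hbS, hbspan, hbli⟩ := exists_linearIndependent ℝ S
  let B : Basis b ℝ E := Basis.mk hbli (by rw [Subtype.range_coe, hbspan, hS])
  have hB : ∀ v : b, B v = v.1 := fun v => by simp [B]
  have : Fintype b := FiniteDimensional.fintypeBasisIndex B
  have hcard : Fintype.card b = n := by
    rw [← finrank_eq_card_basis B, finrank_euclideanSpace_fin]
  -- `Φ V v` is the eigenvalue of `V` on the basis vector `v`.
  let Φ : A →ₗ[ℝ] (b → ℝ) := LinearMap.pi fun v =>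
    (B.coord v) ∘ₗ (LinearMap.applyₗ (B v)) ∘ₗ Matrix.toEuclideanLin.toLinearMap ∘ₗ A.subtype
  have hΦ : ∀ V v, Φ V v = B.repr (T V (B v)) v := fun V v => rfl
  have heig : ∀ V (v : b), T V (B v) = Φ V v • B v := fun V v => by
    obtain ⟨c, hc⟩ := hbS v.2 V
    rw [← hB] at hc
    rw [hΦ, hc]
    simp
  have hinj : Function.Injective Φ := by
    rw [injective_iff_map_eq_zero]
    intro V hV
    have h0 : T V = 0 := B.ext fun v => by rw [heig, hV]; simp
    exact Subtype.ext (Matrix.toEuclideanLin.map_eq_zero_iff.1 h0)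
  have hsum : ∀ V, ∑ v, Φ V v = 0 := fun V => by
    have h1 : LinearMap.trace ℝ E (T V) = ∑ v, Φ V v := by
      rw [LinearMap.trace_eq_matrix_trace ℝ B, Matrix.trace]
      exact Finset.sum_congr rfl fun v _ => by simp [LinearMap.toMatrix_apply, hΦ]
    have h2 : LinearMap.trace ℝ E (T V) = V.1.trace := by
      simp only [T]
      rw [show Matrix.toEuclideanLin = _ from Matrix.toLpLin_eq_toLin (R := ℝ) (m := Fin n)
        (n := Fin n) 2 2, Matrix.trace_toLin_eq]
    rw [← h1, h2, htr V.1 V.2]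
  have hne : LinearMap.range Φ ≠ ⊤ := fun h => by
    obtain ⟨V, hV⟩ : (fun _ => 1 : b → ℝ) ∈ LinearMap.range Φ := h ▸ Submodule.mem_top
    have := hsum V
    rw [hV] at this
    simp [hcard] at this
    omega
  calc finrank ℝ A = finrank ℝ (LinearMap.range Φ) := (LinearMap.finrank_range_of_inj hinj).symm
    _ < finrank ℝ (b → ℝ) := Submodule.finrank_lt hne
    _ = n := by rw [finrank_fintype_fun_eq_card, hcard]

theorem mem_tangent_basePoint {n : ℕ} {V : Matrix (Fin n) (Fin n) ℝ} :
    V ∈ tangent (basePoint n) ↔ V.IsSymm ∧ V.trace = 0 := by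
  change V.IsSymm ∧ ((1 : Matrix (Fin n) (Fin n) ℝ)⁻¹ * V).trace = 0 ↔ _
  simp

theorem rankX_lt {n : ℕ} (hn : 0 < n) : rankX n < n := by
  refine (Nat.lt_iff_le_pred hn).2 (csSup_le ⟨0, ⊥, bot_le, by simp, by simp⟩ ?_)
  rintro d ⟨A, hA, hcomm, rfl⟩
  exact (Nat.lt_iff_le_pred hn).1 <| finrank_lt_of_commute_of_trace_eq_zero hn A
    (fun V hV => (mem_tangent_basePoint.1 (hA hV)).1)
    (fun V hV => (mem_tangent_basePoint.1 (hA hV)).2) hcomm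

/-! ### The tangent space of `X_{n-1} × ℝ` -/

section Block

variable {n : ℕ} (l : Fin n)

/-- The symmetric trace-free matrices whose row (and hence column) of index `l` vanishes. If `l` is
the last index, this is the tangent space of the factor `X_{n-1}` of `X_{n-1} × ℝ` at the base
point. -/
def blockTangent : Submodule ℝ (Matrix (Fin n) (Fin n) ℝ) where
  carrier := {V | V.IsSymm ∧ V.trace = 0 ∧ ∀ j, V l j = 0}
  add_mem' := by
    rintro V W ⟨hV, hV', hV''⟩ ⟨hW, hW', hW''⟩
    exact ⟨hV.add hW, by simp [hV', hW'], by simp [hV'', hW'']⟩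
  zero_mem' := ⟨Matrix.isSymm_zero, by simp, by simp⟩
  smul_mem' := by
    rintro c V ⟨hV, hV', hV''⟩
    exact ⟨hV.smul c, by simp [hV'], by simp [hV'']⟩

/-- The symmetric matrix `E_{al} + E_{la}`. -/
def offDiag (a : Fin n) : Matrix (Fin n) (Fin n) ℝ := Matrix.single a l 1 + Matrix.single l a 1

/-- The trace-free diagonal matrix with entries `1`, except for the entry `1 - n` at `l`; it
spans the direction of the factor `ℝ`. -/
def axis : Matrix (Fin n) (Fin n) ℝ := 1 - Matrix.single l l (n : ℝ)

theorem axis_isSymm : (axis l).IsSymm := by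
  simp [Matrix.IsSymm, axis]

theorem axis_trace : (axis l).trace = 0 := by
  simp [axis, Matrix.trace_single_eq_same]

theorem offDiag_isSymm (a : Fin n) : (offDiag l a).IsSymm := by
  simp [Matrix.IsSymm, offDiag, add_comm]

theorem offDiag_trace {a : Fin n} (h : a ≠ l) : (offDiag l a).trace = 0 := by
  simp [offDiag, Matrix.trace_single_eq_of_ne, h, h.symm]

/-- The row of index `l` maps the trace-free symmetric matrices onto `ℝⁿ`, with kernel
`blockTangent l`. -/
theorem finrank_blockTangent_add_le (hn : 2 ≤ n) :
    Module.finrank ℝ (blockTangent l) + n ≤ dimX n := by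
  let ρ : tangent (basePoint n) →ₗ[ℝ] (Fin n → ℝ) :=
    LinearMap.pi fun j => (Matrix.entryLinearMap ℝ ℝ l j) ∘ₗ (tangent (basePoint n)).subtype
  have hρ : ∀ V j, ρ V j = V.1 l j := fun V j => rfl
  have hn1 : (1 : ℝ) - n ≠ 0 := by
    have : (2 : ℝ) ≤ n := by exact_mod_cast hn
    linarith
  have hsurj : LinearMap.range ρ = ⊤ := by
    rw [eq_top_iff, ← (Pi.basisFun ℝ (Fin n)).span_eq, Submodule.span_le]
    rintro _ ⟨a, rfl⟩
    by_cases ha : a = l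
    · subst ha
      refine ⟨⟨(1 - (n : ℝ))⁻¹ • axis a, Submodule.smul_mem _ _
        (mem_tangent_basePoint.2 ⟨axis_isSymm a, axis_trace a⟩)⟩, ?_⟩
      ext j
      rw [hρ]
      by_cases hj : j = a
      · subst hj; simp [axis, hn1]
      · simp [axis, hj, Ne.symm hj]
    · refine ⟨⟨offDiag l a, mem_tangent_basePoint.2 ⟨offDiag_isSymm l a, offDiag_trace l ha⟩⟩, ?_⟩
      ext j
      rw [hρ]
      by_cases hj : j = a
      · subst hj; simp [offDiag, ha]
      · simp [offDiag, ha, hj, Ne.symm hj]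
  have hker : Module.finrank ℝ (blockTangent l) ≤ Module.finrank ℝ (LinearMap.ker ρ) := by
    let f : blockTangent l →ₗ[ℝ] LinearMap.ker ρ := LinearMap.codRestrict _
      (LinearMap.codRestrict _ (blockTangent l).subtype
        (fun V => mem_tangent_basePoint.2 ⟨V.2.1, V.2.2.1⟩))
      (fun V => by
        rw [LinearMap.mem_ker]
        ext j
        exact V.2.2.2 j)
    refine LinearMap.finrank_le_finrank_of_injective (f := f) fun V W h => Subtype.ext ?_
    exact congrArg (fun U => U.1.1) h
  have := LinearMap.finrank_range_add_finrank_ker ρ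
  rw [hsurj, finrank_top, Module.finrank_fin_fun] at this
  unfold dimX
  omega

/-! ### Infinitesimally invariant alternating forms -/

/-- An alternating form on `Mat_n(ℝ)` is infinitesimally invariant if its restriction to the
trace-free symmetric matrices is annihilated by the Lie algebra `𝔰𝔬(n)`, acting by commutators. -/
def IsInfinitesimallyInvariant {k : ℕ} (T : Matrix (Fin n) (Fin n) ℝ [⋀^Fin k]→ₗ[ℝ] ℝ) : Prop :=
  ∀ (R : Matrix (Fin n) (Fin n) ℝ), Rᵀ = -R → ∀ v : Fin k → Matrix (Fin n) (Fin n) ℝ,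
    (∀ i, v i ∈ tangent (basePoint n)) →
      ∑ i, T (Function.update v i (R * v i - v i * R)) = 0

theorem sum_commutator_offDiag :
    ∑ a ∈ Finset.univ.erase l, ((Matrix.single a l (1 : ℝ) - Matrix.single l a 1) * offDiag l a -
      offDiag l a * (Matrix.single a l 1 - Matrix.single l a 1)) = (2 : ℝ) • axis l := by
  have h1 : ∀ a ∈ Finset.univ.erase l,
      ((Matrix.single a l (1 : ℝ) - Matrix.single l a 1) * offDiag l a -
      offDiag l a * (Matrix.single a l 1 - Matrix.single l a 1)) =
        (2 : ℝ) • (Matrix.single a a (1 : ℝ) - Matrix.single l l 1) := by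
    intro a ha
    have ha : a ≠ l := (Finset.mem_erase.1 ha).1
    simp only [offDiag, sub_mul, mul_sub, mul_add, add_mul, Matrix.single_mul_single_same,
      Matrix.single_mul_single_of_ne, ha, ha.symm, ne_eq, not_false_eq_true, mul_one, two_smul]
    abel
  have h2 : ∑ a : Fin n, Matrix.single a a (1 : ℝ) = 1 := by
    ext i j
    by_cases hij : i = j
    · subst hij
      simp [Matrix.sum_apply, Matrix.single_apply]
    · have : ∀ c : Fin n, ¬ (c = i ∧ c = j) := fun c h => hij (h.1.symm.trans h.2)
      simp [Matrix.sum_apply, hij, this]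
  rw [Finset.sum_congr rfl h1, ← Finset.smul_sum, Finset.sum_erase _ (by simp),
    Finset.sum_sub_distrib, h2, Finset.sum_const, Finset.card_univ, Fintype.card_fin, axis]
  simp [Matrix.smul_single]

theorem commutator_blockTangent {w : Matrix (Fin n) (Fin n) ℝ} (hw : w ∈ blockTangent l)
    (a : Fin n) :
    (Matrix.single a l (1 : ℝ) - Matrix.single l a 1) * w -
      w * (Matrix.single a l 1 - Matrix.single l a 1) =
        -∑ b ∈ Finset.univ.erase l, w a b • offDiag l b := by
  obtain ⟨hs, -, h0⟩ := hw
  have h0' : ∀ j, w j l = 0 := fun j => by rw [← hs.apply, h0]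
  rw [Finset.sum_erase _ (by simp [h0'])]
  have e1 : Matrix.single a l (1 : ℝ) * w = 0 := by
    ext i j
    by_cases hi : i = a
    · subst hi; simp [h0]
    · simp [Matrix.single_mul_apply_of_ne, hi]
  have e2 : w * Matrix.single l a (1 : ℝ) = 0 := by
    ext i j
    by_cases hj : j = a
    · subst hj; simp [h0']
    · simp [Matrix.mul_single_apply_of_ne, hj]
  have e3 : Matrix.single l a (1 : ℝ) * w = ∑ b, w a b • Matrix.single l b (1 : ℝ) := by
    ext i j
    by_cases hi : i = l
    · subst hi; simp [Matrix.sum_apply, Matrix.single_apply]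
    · simp [Matrix.sum_apply, Matrix.single_mul_apply_of_ne, hi, Ne.symm hi]
  have e4 : w * Matrix.single a l (1 : ℝ) = ∑ b, w a b • Matrix.single b l (1 : ℝ) := by
    ext i j
    by_cases hj : j = l
    · subst hj; simp [Matrix.sum_apply, Matrix.single_apply, hs.apply a i]
    · simp [Matrix.sum_apply, Matrix.mul_single_apply_of_ne, hj, Ne.symm hj]
  simp only [offDiag, sub_mul, mul_sub, smul_add, Finset.sum_add_distrib, e1, e2, ← e3, ← e4]
  abel

/-- Contraction with the axis kills an infinitesimally invariant form on the tangent space of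
`X_{n-1}`. Put `S_a = E_{al} + E_{la}` into the slot `i₀` and add up the invariance under the
rotations `R_a = E_{al} - E_{la}` over all `a ≠ l`. The slot `i₀` contributes
`∑ [R_a, S_a] = 2 axis`. A slot `i ≠ i₀` contributes `-∑ w_{ab} T(…, S_a, …, S_b, …)`, which
vanishes because `w` is symmetric and `T` is alternating. -/
theorem map_axis_eq_zero {k : ℕ} {T : Matrix (Fin n) (Fin n) ℝ [⋀^Fin k]→ₗ[ℝ] ℝ}
    (hT : IsInfinitesimallyInvariant T) (i₀ : Fin k) (w : Fin k → Matrix (Fin n) (Fin n) ℝ)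
    (hw : ∀ i, i ≠ i₀ → w i ∈ blockTangent l) :
    T (Function.update w i₀ (axis l)) = 0 := by
  have key : ∀ a ∈ Finset.univ.erase l,
      T (Function.update w i₀ ((Matrix.single a l (1 : ℝ) - Matrix.single l a 1) * offDiag l a -
        offDiag l a * (Matrix.single a l 1 - Matrix.single l a 1))) =
      ∑ i ∈ Finset.univ.erase i₀, ∑ b ∈ Finset.univ.erase l,
        w i a b * T (Function.update (Function.update w i₀ (offDiag l a)) i (offDiag l b)) := by
    intro a ha
    have ha' : a ≠ l := (Finset.mem_erase.1 ha).1
    have h := hT (Matrix.single a l (1 : ℝ) - Matrix.single l a 1) (by simp)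
      (Function.update w i₀ (offDiag l a)) (fun i => by
        by_cases hi : i = i₀
        · subst hi
          simpa using mem_tangent_basePoint.2 ⟨offDiag_isSymm l a, offDiag_trace l ha'⟩
        · rw [Function.update_of_ne hi]
          exact mem_tangent_basePoint.2 ⟨(hw i hi).1, (hw i hi).2.1⟩)
    rw [← Finset.add_sum_erase _ _ (Finset.mem_univ i₀)] at h
    simp only [Function.update_self, Function.update_idem] at h
    rw [eq_neg_of_add_eq_zero_left h, ← Finset.sum_neg_distrib]
    refine Finset.sum_congr rfl fun i hi => ?_
    have hi : i ≠ i₀ := (Finset.mem_erase.1 hi).1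
    rw [Function.update_of_ne hi, commutator_blockTangent l (hw i hi),
      AlternatingMap.map_update_neg, neg_neg, AlternatingMap.map_update_sum]
    simp [AlternatingMap.map_update_smul]
  have hswap : ∀ i, i ≠ i₀ → ∑ a ∈ Finset.univ.erase l, ∑ b ∈ Finset.univ.erase l,
      w i a b * T (Function.update (Function.update w i₀ (offDiag l a)) i (offDiag l b)) = 0 := by
    intro i hi
    have hanti : ∀ a b, T (Function.update (Function.update w i₀ (offDiag l a)) i (offDiag l b)) =
        -T (Function.update (Function.update w i₀ (offDiag l b)) i (offDiag l a)) := by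
      intro a b
      rw [← T.map_swap _ hi]
      congr 1
      ext j : 1
      by_cases h1 : j = i
      · subst h1; simp [Ne.symm hi]
      · by_cases h2 : j = i₀
        · subst h2; simp [Ne.symm hi]
        · simp [h1, h2, Equiv.swap_apply_of_ne_of_ne]
    have hself : ∀ x : ℝ, x = -x → x = 0 := fun x hx => by linarith
    apply hself
    conv_lhs => rw [Finset.sum_comm]
    rw [← Finset.sum_neg_distrib]
    refine Finset.sum_congr rfl fun a _ => ?_
    rw [← Finset.sum_neg_distrib]
    refine Finset.sum_congr rfl fun b _ => ?_
    rw [hanti b a, (hw i hi).1.apply a b]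
    ring
  have h2 : (2 : ℝ) * T (Function.update w i₀ (axis l)) = 0 := by
    rw [← smul_eq_mul, ← AlternatingMap.map_update_smul, ← sum_commutator_offDiag,
      AlternatingMap.map_update_sum, Finset.sum_congr rfl key, Finset.sum_comm]
    exact Finset.sum_eq_zero fun i hi => hswap i (Finset.mem_erase.1 hi).1
  simpa using h2

/-- An infinitesimally invariant form of degree greater than `dim X_{n-1}` vanishes on the tangent
space of `X_{n-1} × ℝ`: in the multilinear expansion, the term without the axis is alternating in
too many vectors, the terms with the axis once vanish by `map_axis_eq_zero`, and those with the axis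
twice vanish trivially. -/
theorem map_span_axis_sup_eq_zero {k : ℕ} {T : Matrix (Fin n) (Fin n) ℝ [⋀^Fin k]→ₗ[ℝ] ℝ}
    (hT : IsInfinitesimallyInvariant T) (hk : Module.finrank ℝ (blockTangent l) < k)
    (c : Fin k → ℝ) (w : Fin k → Matrix (Fin n) (Fin n) ℝ) (hw : ∀ i, w i ∈ blockTangent l) :
    T (fun i => c i • axis l + w i) = 0 := by
  have := T.toMultilinearMap.map_add_univ (fun i => c i • axis l) w
  change T (fun i => c i • axis l + w i) = _ at this
  rw [this]
  refine Finset.sum_eq_zero fun s _ => ?_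
  change T (s.piecewise (fun i => c i • axis l) w) = 0
  rcases s.eq_empty_or_nonempty with rfl | ⟨i₀, hi₀⟩
  · rw [Finset.piecewise_empty]
    refine T.map_linearDependent w fun hli => ?_
    have hli' : LinearIndependent ℝ (fun i => (⟨w i, hw i⟩ : blockTangent l)) :=
      LinearIndependent.of_comp (blockTangent l).subtype hli
    have := hli'.fintype_card_le_finrank
    rw [Fintype.card_fin] at this
    omega
  · set f := s.piecewise (fun i => c i • axis l) w with hf
    have hfs : ∀ i ∈ s, f i = c i • axis l := fun i hi => by simp [f, hi]
    have h0 : T f = c i₀ * T (Function.update f i₀ (axis l)) := by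
      rw [← smul_eq_mul, ← AlternatingMap.map_update_smul, ← hfs i₀ hi₀, Function.update_eq_self]
    rw [h0]
    by_cases h : ∃ i₁ ∈ s, i₁ ≠ i₀
    · obtain ⟨i₁, hi₁, hne⟩ := h
      have h1 : Function.update f i₀ (axis l) =
          Function.update (Function.update f i₀ (axis l)) i₁ (c i₁ • axis l) := by
        rw [← hfs i₁ hi₁, eq_comm, Function.update_eq_self_iff, Function.update_of_ne hne]
      rw [h1, AlternatingMap.map_update_smul, T.map_eq_zero_of_eq _ (i := i₁) (j := i₀) ?_ hne]
      · simp
      · simp [Ne.symm hne]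
    · push Not at h
      rw [map_axis_eq_zero l hT i₀ f fun i hi => ?_, mul_zero]
      have : i ∉ s := fun his => hi (h i his)
      simpa [f, this] using hw i

end Block

end SLSym

/-! ### Alternating forms on finite-dimensional spaces -/

theorem AlternatingMap.apply_eq_sum_finBasis {E ι : Type*} [AddCommGroup E] [Module ℝ E]
    [FiniteDimensional ℝ E] [Fintype ι] [DecidableEq ι] (T : E [⋀^ι]→ₗ[ℝ] ℝ) (v : ι → E) :
    T v = ∑ r : ι → Fin (Module.finrank ℝ E),
      (∏ i, (Module.finBasis ℝ E).coord (r i) (v i)) * T fun i => Module.finBasis ℝ E (r i) := by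
  have h : v = fun i => ∑ j, (Module.finBasis ℝ E).coord j (v i) • Module.finBasis ℝ E j := by
    ext i
    exact ((Module.finBasis ℝ E).sum_repr (v i)).symm
  conv_lhs => rw [h]
  refine (T.toMultilinearMap.map_sum
    (fun i j => (Module.finBasis ℝ E).coord j (v i) • Module.finBasis ℝ E j)).trans ?_
  exact Finset.sum_congr rfl fun r _ => T.toMultilinearMap.map_smul_univ _ _

theorem AlternatingMap.continuous_of_finiteDimensional {E ι : Type*} [NormedAddCommGroup E]
    [NormedSpace ℝ E] [FiniteDimensional ℝ E] [Fintype ι] (T : E [⋀^ι]→ₗ[ℝ] ℝ) :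
    Continuous T := by
  classical
  rw [funext T.apply_eq_sum_finBasis]
  refine continuous_finsetSum _ fun r _ => ?_
  refine (continuous_finsetProd _ fun i _ => ?_).mul continuous_const
  exact (LinearMap.continuous_of_finiteDimensional _).comp (continuous_apply i)

theorem ContinuousAlternatingMap.contDiff_of_forall_apply {X E ι : Type*} [NormedAddCommGroup X]
    [NormedSpace ℝ X] [NormedAddCommGroup E] [NormedSpace ℝ E] [FiniteDimensional ℝ E] [Fintype ι]
    {r : WithTop ℕ∞} {f : X → E [⋀^ι]→L[ℝ] ℝ} (hf : ∀ v, ContDiff ℝ r fun x => f x v) :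
    ContDiff ℝ r f := by
  classical
  let b := Module.finBasis ℝ E
  let Φ : (E [⋀^ι]→L[ℝ] ℝ) →ₗ[ℝ] ((ι → Fin (Module.finrank ℝ E)) → ℝ) :=
    { toFun := fun T r => T fun i => b (r i)
      map_add' := fun _ _ => rfl
      map_smul' := fun _ _ => rfl }
  have hΦ : LinearMap.ker Φ = ⊥ := by
    rw [LinearMap.ker_eq_bot]
    intro T U h
    refine ContinuousAlternatingMap.toAlternatingMap_injective (b.ext_alternating fun r _ => ?_)
    exact congrFun h r
  obtain ⟨Ψ, hΨ⟩ := Φ.exists_leftInverse_of_injective hΦ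
  have h : f = fun x => LinearMap.toContinuousLinearMap Ψ (Φ (f x)) := by
    ext1 x
    exact (LinearMap.congr_fun hΨ (f x)).symm
  rw [h]
  exact (ContinuousLinearMap.contDiff _).comp (contDiff_pi.2 fun r => hf _)

/-! ### Forms on matrix spaces and tangency -/

attribute [local instance] Matrix.linftyOpNormedRing Matrix.linftyOpNormedAlgebra

/-- The topology of a matrix space, as the topology of its norm. It agrees with the product
topology, but instance search cannot see this; as a local instance it takes precedence over the
latter, which makes the continuous alternating forms on a matrix space a normed space. -/
abbrev Matrix.normTopology (n : ℕ) : TopologicalSpace (Matrix (Fin n) (Fin n) ℝ) :=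
  (Matrix.linftyOpNormedRing :
    NormedRing (Matrix (Fin n) (Fin n) ℝ)).toPseudoMetricSpace.toUniformSpace.toTopologicalSpace

attribute [local instance] Matrix.normTopology

namespace SLSym

variable {n k : ℕ}

theorem contDiff_matrix_iff {X : Type*} [NormedAddCommGroup X] [NormedSpace ℝ X] {r : WithTop ℕ∞}
    {F : X → Matrix (Fin n) (Fin n) ℝ} :
    ContDiff ℝ r F ↔ ∀ a b, ContDiff ℝ r fun x => F x a b := by
  let e : Matrix (Fin n) (Fin n) ℝ ≃L[ℝ] (Fin n → Fin n → ℝ) :=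
    (Matrix.ofLinearEquiv ℝ).symm.toContinuousLinearEquiv
  rw [← e.comp_contDiff_iff, contDiff_pi]
  exact forall_congr' fun a => contDiff_pi

/-- A differential form as a map from matrices to continuous alternating forms. -/
def DiffForm.form (η : DiffForm n k) (P : Matrix (Fin n) (Fin n) ℝ) :
    Matrix (Fin n) (Fin n) ℝ [⋀^Fin k]→L[ℝ] ℝ :=
  { η.toFun P with cont := (η.toFun P).continuous_of_finiteDimensional }

theorem DiffForm.contDiff_apply (η : DiffForm n k) (v : Fin k → Matrix (Fin n) (Fin n) ℝ) :
    ContDiff ℝ ∞ fun P => η.toFun P v :=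
  (η.smooth v).comp ((Matrix.ofLinearEquiv ℝ).symm.toContinuousLinearEquiv :
    Matrix (Fin n) (Fin n) ℝ ≃L[ℝ] (Fin n → Fin n → ℝ)).contDiff

theorem DiffForm.contDiff_form (η : DiffForm n k) : ContDiff ℝ ∞ η.form :=
  ContinuousAlternatingMap.contDiff_of_forall_apply η.contDiff_apply

theorem contDiff_entry (a b : Fin n) :
    ContDiff ℝ ∞ fun A : Matrix (Fin n) (Fin n) ℝ => A a b :=
  contDiff_matrix_iff.1 contDiff_id a b

theorem contDiff_det : ContDiff ℝ ∞ fun A : Matrix (Fin n) (Fin n) ℝ => A.det := by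
  simp only [Matrix.det_apply]
  exact ContDiff.sum fun σ _ => (contDiff_prod fun i _ => contDiff_entry _ _).const_smul _

/-- Jacobi's formula for the derivative of the determinant. -/
theorem fderiv_det_apply {P : Matrix (Fin n) (Fin n) ℝ} (hP : IsUnit P.det)
    (V : Matrix (Fin n) (Fin n) ℝ) :
    fderiv ℝ (fun A : Matrix (Fin n) (Fin n) ℝ => A.det) P V = P.det * (P⁻¹ * V).trace := by
  have h1 : HasDerivAt (fun t : ℝ => (P + t • V).det)
      (fderiv ℝ (fun A : Matrix (Fin n) (Fin n) ℝ => A.det) P V) 0 := by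
    have hd : HasFDerivAt (fun A : Matrix (Fin n) (Fin n) ℝ => A.det)
        (fderiv ℝ (fun A : Matrix (Fin n) (Fin n) ℝ => A.det) P) (P + (0 : ℝ) • V) := by
      rw [zero_smul, add_zero]
      exact (contDiff_det.differentiable (by simp)).differentiableAt.hasFDerivAt
    have hc : HasDerivAt (fun t : ℝ => P + t • V) V 0 := by
      simpa using! ((hasDerivAt_id (0 : ℝ)).smul_const V).const_add P
    exact hd.comp_hasDerivAt 0 hc
  have h2 : HasDerivAt (fun t : ℝ => (P + t • V).det) (P.det * (P⁻¹ * V).trace) 0 := by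
    have h3 : (fun t : ℝ => (P + t • V).det) = fun t => P.det * (1 + (P⁻¹ * V).trace * t +
        (Matrix.det (1 + (Polynomial.X : Polynomial ℝ) •
          (P⁻¹ * V).map Polynomial.C)).divX.divX.eval t * t ^ 2) := by
      ext t
      rw [← Matrix.det_one_add_smul, ← Matrix.det_mul, mul_add, mul_one, Matrix.mul_smul,
        Matrix.mul_nonsing_inv_cancel_left _ _ hP]
    rw [h3]
    set p := (Matrix.det (1 + (Polynomial.X : Polynomial ℝ) •
          (P⁻¹ * V).map Polynomial.C)).divX.divX
    have h4 := ((((hasDerivAt_id (0 : ℝ)).const_mul (P⁻¹ * V).trace).const_add 1).add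
      ((p.hasDerivAt 0).mul ((hasDerivAt_id (0 : ℝ)).pow 2))).const_mul P.det
    simpa using h4
  exact h1.unique h2

/-- If `φ ∘ G` is constant on a set with unique derivatives, then the derivative of `φ` vanishes on
the image of the derivative of `G`. -/
theorem map_fderiv_eq_zero {X E : Type*} [NormedAddCommGroup X] [NormedSpace ℝ X]
    [NormedAddCommGroup E] [NormedSpace ℝ E] {S : Set X} {s : X}
    {G : X → E} (hG : DifferentiableAt ℝ G s) (hs : s ∈ S)
    (hS : UniqueDiffWithinAt ℝ S s) (φ : E → ℝ) (c : ℝ) (hφ : DifferentiableAt ℝ φ (G s))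
    (h : ∀ x ∈ S, φ (G x) = c) (u : X) : fderiv ℝ φ (G s) (fderiv ℝ G s u) = 0 := by
  have h1 : HasFDerivWithinAt (fun x => φ (G x)) ((fderiv ℝ φ (G s)).comp (fderiv ℝ G s)) S s :=
    (hφ.hasFDerivAt.comp s hG.hasFDerivAt).hasFDerivWithinAt
  have h2 : HasFDerivWithinAt (fun x => φ (G x)) (0 : X →L[ℝ] ℝ) S s :=
    (hasFDerivWithinAt_const c s S).congr h (h s hs)
  exact DFunLike.congr_fun (hS.eq h1 h2) u

/-- The derivative of a map into `X_n` is tangent to `X_n`. -/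
theorem fderiv_mem_tangent {X : Type*} [NormedAddCommGroup X] [NormedSpace ℝ X] {S : Set X} {s : X}
    {G : X → Matrix (Fin n) (Fin n) ℝ} (hG : DifferentiableAt ℝ G s) (hs : s ∈ S)
    (hS : UniqueDiffWithinAt ℝ S s) (hGS : ∀ x ∈ S, ∃ P : Space n, G x = P.1) (P : Space n)
    (hP : G s = P.1) (u : X) : fderiv ℝ G s u ∈ tangent P := by
  constructor
  · ext a b
    let φ : Matrix (Fin n) (Fin n) ℝ →L[ℝ] ℝ := LinearMap.toContinuousLinearMap
      (Matrix.entryLinearMap ℝ ℝ b a - Matrix.entryLinearMap ℝ ℝ a b)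
    have h := map_fderiv_eq_zero hG hs hS φ 0 φ.differentiableAt (fun x hx => by
      obtain ⟨Q, hQ⟩ := hGS x hx
      have := Q.2.1.isHermitian.apply b a
      rw [hQ]
      change Q.1 b a - Q.1 a b = 0
      rw [← this]
      simp) u
    rw [φ.fderiv] at h
    exact sub_eq_zero.1 h
  · have hdet : P.1.det = 1 := P.2.2
    have h := map_fderiv_eq_zero hG hs hS (fun A : Matrix (Fin n) (Fin n) ℝ => A.det) 1
      (contDiff_det.differentiable (by simp)).differentiableAt (fun x hx => by
        obtain ⟨Q, hQ⟩ := hGS x hx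
        rw [hQ]
        exact Q.2.2) u
    rw [hP] at h
    have h' := fderiv_det_apply (P := P.1) (by rw [hdet]; exact isUnit_one) (fderiv ℝ G s u)
    rw [hdet, one_mul] at h'
    exact h'.symm.trans h

end SLSym

/-! ### Invariance and closedness -/

namespace SLSym

variable {n k : ℕ}

/-- `Matrix.exp_transpose` for the topology `Matrix.normTopology`. -/
theorem transpose_exp (A : Matrix (Fin n) (Fin n) ℝ) :
    (NormedSpace.exp A)ᵀ = NormedSpace.exp Aᵀ := (Matrix.exp_transpose A).symm

theorem exp_skew_mul_transpose {R : Matrix (Fin n) (Fin n) ℝ} (hR : Rᵀ = -R) (t : ℝ) :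
    NormedSpace.exp (t • R) * (NormedSpace.exp (t • R))ᵀ = 1 := by
  rw [transpose_exp, Matrix.transpose_smul, hR, smul_neg]
  rw [← NormedSpace.exp_add_of_commute (Commute.neg_right (Commute.refl _))]
  simp

/-- As `exp (tR)` is orthogonal and a square, its determinant is one. -/
theorem det_exp_skew {R : Matrix (Fin n) (Fin n) ℝ} (hR : Rᵀ = -R) (t : ℝ) :
    (NormedSpace.exp (t • R)).det = 1 := by
  have h1 : ∀ s : ℝ, (NormedSpace.exp (s • R)).det * (NormedSpace.exp (s • R)).det = 1 :=
      fun s => by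
    have := congrArg Matrix.det (exp_skew_mul_transpose hR s)
    rwa [Matrix.det_mul, Matrix.det_transpose, Matrix.det_one] at this
  have h2 : t • R = (t / 2) • R + (t / 2) • R := by rw [← add_smul, add_halves]
  rw [h2, NormedSpace.exp_add_of_commute (Commute.refl _), Matrix.det_mul, h1]

theorem DiffForm.IsInvariant.form_conj {η : DiffForm n k} (hη : η.IsInvariant)
    {g : Matrix (Fin n) (Fin n) ℝ} (hg : g.det = 1) (P : Space n)
    {v : Fin k → Matrix (Fin n) (Fin n) ℝ} (hv : ∀ i, v i ∈ tangent P) :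
    η.form (g * P.1 * gᵀ) (fun i => g * v i * gᵀ) = η.form P.1 v :=
  hη ⟨g, hg⟩ P v hv

/-- The value of an invariant form at the base point is invariant under the one-parameter subgroups
`exp (tR)` of the stabiliser `SO(n)`; differentiate at `t = 0`. -/
theorem DiffForm.IsInvariant.isInfinitesimallyInvariant {η : DiffForm n k} (hη : η.IsInvariant) :
    IsInfinitesimallyInvariant (η.toFun 1) := by
  intro R hR v hv
  let g : ℝ → Matrix (Fin n) (Fin n) ℝ := fun t => NormedSpace.exp (t • R)
  have hconst : ∀ t, η.form 1 (fun i => g t * v i * NormedSpace.exp (t • -R)) = η.form 1 v := by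
    intro t
    have h := hη.form_conj (det_exp_skew hR t) (basePoint n) hv
    have h1 : NormedSpace.exp (t • R) * (basePoint n).1 * (NormedSpace.exp (t • R))ᵀ = 1 :=
      (congrArg (· * _) (mul_one _)).trans (exp_skew_mul_transpose hR t)
    rw [h1] at h
    have h2 : (g t)ᵀ = NormedSpace.exp (t • -R) := by
      rw [transpose_exp, Matrix.transpose_smul, hR]
    rw [← h2]
    exact h
  have hpath : HasDerivAt (fun t i => g t * v i * NormedSpace.exp (t • -R))
      (fun i => R * v i - v i * R) 0 := by
    refine hasDerivAt_pi.2 fun i => ?_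
    have h1 := hasDerivAt_exp_smul_const (𝕂 := ℝ) R (0 : ℝ)
    have h2 := hasDerivAt_exp_smul_const (𝕂 := ℝ) (-R) (0 : ℝ)
    have h3 := (h1.mul_const (v i)).mul h2
    have h4 : R * v i - v i * R = NormedSpace.exp ((0 : ℝ) • R) * R * v i *
        NormedSpace.exp ((0 : ℝ) • -R) + NormedSpace.exp ((0 : ℝ) • R) * v i *
        (NormedSpace.exp ((0 : ℝ) • -R) * -R) := by
      simp [sub_eq_add_neg]
    rw [h4]
    exact h3
  have h0 : (fun i => g 0 * v i * NormedSpace.exp ((0 : ℝ) • -R)) = v := by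
    ext1 i
    simp [g]
  have hderiv := ((η.form 1).hasFDerivAt
    (fun i => g 0 * v i * NormedSpace.exp ((0 : ℝ) • -R))).comp_hasDerivAt (0 : ℝ) hpath
  have hzero : HasDerivAt (fun t => η.form 1 (fun i => g t * v i * NormedSpace.exp (t • -R)))
      0 0 := by
    simp only [hconst]
    exact hasDerivAt_const _ _
  have := hderiv.unique hzero
  rw [h0, ContinuousMultilinearMap.linearDeriv_apply] at this
  exact this

/-- The geodesic symmetry `P ↦ P₀ P⁻¹ P₀` at `P₀` moves a given `P` to the same point as the element
`P₀ P⁻¹` of `SL_n(ℝ)` does, and its derivative at `P` is the negative of the action of that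
element. Hence it pulls an invariant `k`-form `η` back to `(-1)^k η`. -/
theorem DiffForm.IsInvariant.symmetry {η : DiffForm n k} (hη : η.IsInvariant) (P₀ P : Space n)
    {v : Fin k → Matrix (Fin n) (Fin n) ℝ} (hv : ∀ i, v i ∈ tangent P) :
    η.form (P₀.1 * P.1⁻¹ * P₀.1) (fun i => P₀.1 * P.1⁻¹ * v i * P.1⁻¹ * P₀.1) = η.form P.1 v := by
  have hdet : ∀ Q : Space n, Q.1.det = 1 := fun Q => Q.2.2
  have hsymm : ∀ Q : Space n, Q.1ᵀ = Q.1 := fun Q => by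
    have := Q.2.1.isHermitian.eq
    rwa [Matrix.conjTranspose_eq_transpose_of_trivial] at this
  have hg : (P₀.1 * P.1⁻¹).det = 1 := by
    rw [Matrix.det_mul, Matrix.det_nonsing_inv, hdet, hdet]; simp
  have hgT : (P₀.1 * P.1⁻¹)ᵀ = P.1⁻¹ * P₀.1 := by
    rw [Matrix.transpose_mul, Matrix.transpose_nonsing_inv, hsymm, hsymm]
  have h := hη.form_conj hg P hv
  have hu : IsUnit P.1.det := by rw [hdet]; exact isUnit_one
  have e1 : P₀.1 * P.1⁻¹ * P.1 * (P₀.1 * P.1⁻¹)ᵀ = P₀.1 * P.1⁻¹ * P₀.1 := by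
    rw [hgT, Matrix.nonsing_inv_mul_cancel_right _ _ hu, Matrix.mul_assoc]
  have e2 : (fun i => P₀.1 * P.1⁻¹ * v i * (P₀.1 * P.1⁻¹)ᵀ) =
      fun i => P₀.1 * P.1⁻¹ * v i * P.1⁻¹ * P₀.1 := by
    ext1 i
    rw [hgT, Matrix.mul_assoc _ P.1⁻¹ P₀.1]
  rw [e1, e2] at h
  exact h

/-- The pull-back of a form under a map into matrices (zero where the map is not differentiable,
except in degree zero). -/
def DiffForm.pullback (η : DiffForm n k) {X : Type*} [NormedAddCommGroup X] [NormedSpace ℝ X]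
    (G : X → Matrix (Fin n) (Fin n) ℝ) (x : X) : X [⋀^Fin k]→L[ℝ] ℝ :=
  (η.form (G x)).compContinuousLinearMap (fderiv ℝ G x)

theorem DiffForm.contDiff_pullback (η : DiffForm n k) {X : Type*} [NormedAddCommGroup X]
    [NormedSpace ℝ X] [FiniteDimensional ℝ X] {G : X → Matrix (Fin n) (Fin n) ℝ}
    (hG : ContDiff ℝ ∞ G) : ContDiff ℝ 1 (η.pullback G) := by
  refine ContinuousAlternatingMap.contDiff_of_forall_apply fun v => ?_
  have h : (fun x => η.pullback G x v) = fun x => _ :=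
    funext fun x => (η.toFun (G x)).apply_eq_sum_finBasis fun i => fderiv ℝ G x (v i)
  rw [h]
  refine ContDiff.sum fun r _ => (contDiff_prod fun i _ => ?_).mul ?_
  · have h1 : ContDiff ℝ 1 fun x => fderiv ℝ G x (v i) :=
      (hG.fderiv_right (m := 1) (WithTop.coe_le_coe.2 le_top)).clm_apply contDiff_const
    exact (LinearMap.toContinuousLinearMap
      ((Module.finBasis ℝ (Matrix (Fin n) (Fin n) ℝ)).coord (r i))).contDiff.comp h1
  · exact ((η.contDiff_apply _).comp hG).of_le (WithTop.coe_le_coe.2 le_top)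

/-- Cartan's theorem that invariant forms on a symmetric space are closed, for the pull-back under a
map `G` into `X_n`. The geodesic symmetry at `G s` multiplies `η` by `(-1)^k`, hence `dη` as well,
while its derivative `-1` at `G s` multiplies the `(k + 1)`-form `dη` by `(-1)^(k + 1)` there. -/
theorem DiffForm.IsInvariant.extDeriv_pullback_eq_zero {η : DiffForm n k} (hη : η.IsInvariant)
    {X : Type*} [NormedAddCommGroup X] [NormedSpace ℝ X]
    {G : X → Matrix (Fin n) (Fin n) ℝ} (hG : ContDiff ℝ ∞ G) {s : X}
    (hs : ∀ᶠ x in nhds s, ∃ P : Space n, G x = P.1) : extDeriv (η.pullback G) s = 0 := by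
  have : CompleteSpace (Matrix (Fin n) (Fin n) ℝ) := FiniteDimensional.complete ℝ _
  obtain ⟨P₀, hP₀⟩ := hs.self_of_nhds
  -- `G'` is the composition of `G` with the geodesic symmetry at `P₀ = G s`.
  let G' : X → Matrix (Fin n) (Fin n) ℝ := fun x => P₀.1 * Ring.inverse (G x) * P₀.1
  have hGd : ∀ x, HasFDerivAt G (fderiv ℝ G x) x := fun x =>
    (hG.differentiable (by simp)).differentiableAt.hasFDerivAt
  have hunit : ∀ P : Space n, ∃ u : (Matrix (Fin n) (Fin n) ℝ)ˣ, u = P.1 := fun P =>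
    (Matrix.isUnit_iff_isUnit_det P.1).2 (by rw [show P.1.det = 1 from P.2.2]; exact isUnit_one)
  have hG'd : ∀ x (P : Space n), G x = P.1 → ∀ u, fderiv ℝ G' x u =
      -(P₀.1 * P.1⁻¹ * fderiv ℝ G x u * P.1⁻¹ * P₀.1) := by
    intro x P hP u
    obtain ⟨U, hU⟩ := hunit P
    have h1 : HasFDerivAt Ring.inverse (-ContinuousLinearMap.mulLeftRight ℝ
        (Matrix (Fin n) (Fin n) ℝ) ↑U⁻¹ ↑U⁻¹) (G x) := by
      rw [hP, ← hU]
      exact hasFDerivAt_ringInverse (𝕜 := ℝ) U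
    have h2 := ((h1.comp x (hGd x)).const_mul P₀.1).mul_const' P₀.1
    have h3 : ((U⁻¹ : (Matrix (Fin n) (Fin n) ℝ)ˣ) : Matrix (Fin n) (Fin n) ℝ) = P.1⁻¹ := by
      rw [Matrix.coe_units_inv, hU]
    have h4 : fderiv ℝ G' x = _ := HasFDerivAt.fderiv h2
    rw [h4]
    simp [h3, mul_assoc]
  have hG's : ContDiffAt ℝ ∞ G' s := by
    obtain ⟨U, hU⟩ := hunit P₀
    have h1 : ContDiffAt ℝ ∞ Ring.inverse (G s) := by
      rw [hP₀, ← hU]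
      exact contDiffAt_ringInverse ℝ U
    exact (contDiffAt_const.mul (h1.comp s hG.contDiffAt)).mul contDiffAt_const
  have hG's₀ : G' s = G s := by
    obtain ⟨U, hU⟩ := hunit P₀
    simp only [G']
    rw [hP₀, ← hU]
    simp
  have hG'P : ∀ x (P : Space n), G x = P.1 → G' x = P₀.1 * P.1⁻¹ * P₀.1 := by
    intro x P hP
    simp only [G', hP, Matrix.nonsing_inv_eq_ringInverse]
  have hsign : η.pullback G' =ᶠ[nhds s] ((-1 : ℝ) ^ k) • η.pullback G := by
    filter_upwards [eventually_eventually_nhds.2 hs] with x hx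
    obtain ⟨P, hP⟩ := hx.self_of_nhds
    ext v
    have htan : ∀ i, fderiv ℝ G x (v i) ∈ tangent P := fun i =>
      fderiv_mem_tangent (hGd x).differentiableAt (mem_of_mem_nhds hx)
        (uniqueDiffWithinAt_of_mem_nhds hx) (fun y hy => hy) P hP (v i)
    have e1 : η.pullback G' x v = η.form (P₀.1 * P.1⁻¹ * P₀.1)
        (fun i => -(P₀.1 * P.1⁻¹ * fderiv ℝ G x (v i) * P.1⁻¹ * P₀.1)) := by
      rw [← hG'P x P hP]
      simp only [← hG'd x P hP]
      rfl
    have e2 : (fun i => -(P₀.1 * P.1⁻¹ * fderiv ℝ G x (v i) * P.1⁻¹ * P₀.1)) =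
        fun i => (-1 : ℝ) • (P₀.1 * P.1⁻¹ * fderiv ℝ G x (v i) * P.1⁻¹ * P₀.1) := by
      simp
    rw [e1, e2]
    refine ((η.form (P₀.1 * P.1⁻¹ * P₀.1)).toMultilinearMap.map_smul_univ (fun _ => (-1 : ℝ))
      _).trans ?_
    rw [Finset.prod_const, Finset.card_univ, Fintype.card_fin]
    change (-1 : ℝ) ^ k • η.form (P₀.1 * P.1⁻¹ * P₀.1) _ = (-1 : ℝ) ^ k • η.pullback G x v
    congr 1
    refine (hη.symmetry P₀ P htan).trans ?_
    rw [← hP]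
    rfl
  have hform : DifferentiableAt ℝ η.form (G s) :=
    (η.contDiff_form.differentiable (by simp)).differentiableAt
  have hle : minSmoothness ℝ 2 ≤ ∞ := by
    rw [minSmoothness_of_isRCLikeNormedField]
    exact WithTop.coe_le_coe.2 le_top
  have h1 : extDeriv (η.pullback G) s =
      (extDeriv η.form (G s)).compContinuousLinearMap (fderiv ℝ G s) :=
    extDeriv_pullback hform hG.contDiffAt hle
  have h2 : extDeriv (η.pullback G') s =
      (extDeriv η.form (G' s)).compContinuousLinearMap (fderiv ℝ G' s) :=
    extDeriv_pullback (by rw [hG's₀]; exact hform) hG's hle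
  have hG'ds : fderiv ℝ G' s = -fderiv ℝ G s := by
    ext1 u
    obtain ⟨U, hU⟩ := hunit P₀
    have hu : IsUnit P₀.1.det := by rw [show P₀.1.det = 1 from P₀.2.2]; exact isUnit_one
    rw [hG'd s P₀ hP₀, Matrix.mul_nonsing_inv _ hu, one_mul, mul_assoc,
      Matrix.nonsing_inv_mul _ hu, mul_one]
    rfl
  rw [hsign.extDeriv_eq, extDeriv_smul, h1, hG's₀, hG'ds] at h2
  ext v
  have h3 := DFunLike.congr_fun h2 v
  change (-1 : ℝ) ^ k • (extDeriv η.form (G s)) (fun i => fderiv ℝ G s (v i)) =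
    (extDeriv η.form (G s)) (fun i => -fderiv ℝ G s (v i)) at h3
  have e2 : (fun i => -fderiv ℝ G s (v i)) = fun i => (-1 : ℝ) • fderiv ℝ G s (v i) := by simp
  have h4 : (extDeriv η.form (G s)) (fun i => (-1 : ℝ) • fderiv ℝ G s (v i)) =
      (-1 : ℝ) ^ (k + 1) • (extDeriv η.form (G s)) (fun i => fderiv ℝ G s (v i)) := by
    refine ((extDeriv η.form (G s)).toMultilinearMap.map_smul_univ (fun _ => (-1 : ℝ))
      _).trans ?_
    rw [Finset.prod_const, Finset.card_univ, Fintype.card_fin]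
    rfl
  rw [e2, h4, pow_succ] at h3
  rw [h1]
  change (extDeriv η.form (G s)) (fun i => fderiv ℝ G s (v i)) = 0
  have hp : (-1 : ℝ) ^ k ≠ 0 := by simp
  have : (-1 : ℝ) ^ k * (extDeriv η.form (G s)) (fun i => fderiv ℝ G s (v i)) = 0 := by
    simp only [smul_eq_mul] at h3
    linarith
  exact (mul_eq_zero.1 this).resolve_left hp

end SLSym

/-! ### Stokes' theorem on the standard simplex -/

namespace SLSym

open MeasureTheory Set

variable {k : ℕ}

theorem sum_baryCoord (s : Fin k → ℝ) : ∑ i, baryCoord s i = 1 := by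
  simp [baryCoord, Fin.sum_univ_succ]

theorem mem_cornerSimplex {s : Fin k → ℝ} :
    s ∈ cornerSimplex k ↔ (∀ i, 0 ≤ s i) ∧ ∑ i, s i ≤ 1 := by
  change (∀ i, 0 ≤ baryCoord s i) ∧ ∑ i, baryCoord s i = 1 ↔ _
  rw [Fin.forall_fin_succ, sum_baryCoord]
  simp only [and_true, baryCoord, Fin.cons_zero, Fin.cons_succ, sub_nonneg]
  exact and_comm

theorem convex_cornerSimplex (k : ℕ) : Convex ℝ (cornerSimplex k) := by
  have : cornerSimplex k = (⋂ i, {s | 0 ≤ s i}) ∩ {s | ∑ i, s i ≤ 1} := by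
    ext s; simp [mem_cornerSimplex]
  rw [this]
  refine (convex_iInter fun i => ?_).inter ?_
  · exact convex_halfSpace_ge (IsLinearMap.mk (fun _ _ => rfl) fun _ _ => rfl) 0
  · exact convex_halfSpace_le (IsLinearMap.mk
      (fun x y => by simp [Finset.sum_add_distrib]) fun c x => by simp [Finset.mul_sum]) 1

theorem isCompact_cornerSimplex (k : ℕ) : IsCompact (cornerSimplex k) := by
  refine (isCompact_Icc (a := (0 : Fin k → ℝ)) (b := 1)).of_isClosed_subset ?_ ?_
  · have : cornerSimplex k = (⋂ i, {s | 0 ≤ s i}) ∩ {s | ∑ i, s i ≤ 1} := by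
      ext s; simp [mem_cornerSimplex]
    rw [this]
    refine (isClosed_iInter fun i => isClosed_le continuous_const (continuous_apply i)).inter ?_
    exact isClosed_le (by fun_prop) continuous_const
  · intro s hs
    rw [mem_cornerSimplex] at hs
    exact ⟨hs.1, fun i => (Finset.single_le_sum (fun j _ => hs.1 j) (Finset.mem_univ i)).trans hs.2⟩

theorem nonempty_interior_cornerSimplex (k : ℕ) : (interior (cornerSimplex k)).Nonempty := by
  refine ⟨fun _ => 1 / ((k : ℝ) + 1), mem_interior.2
    ⟨(⋂ i, {s | 0 < s i}) ∩ {s | ∑ i, s i < 1}, fun s hs => ?_, ?_, ?_⟩⟩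
  · simp only [mem_inter_iff, mem_iInter, mem_ofPred_eq] at hs
    exact mem_cornerSimplex.2 ⟨fun i => (hs.1 i).le, hs.2.le⟩
  · refine (isOpen_iInter_of_finite fun i =>
      isOpen_lt continuous_const (continuous_apply i)).inter ?_
    exact isOpen_lt (by fun_prop) continuous_const
  · have hk : (0 : ℝ) < k + 1 := by positivity
    refine ⟨mem_iInter.2 fun i => by simpa using hk, ?_⟩
    simp only [mem_ofPred_eq, Finset.sum_const, Finset.card_univ, Fintype.card_fin, nsmul_eq_mul]
    rw [mul_one_div, div_lt_one hk]
    linarith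

theorem uniqueDiffOn_cornerSimplex (k : ℕ) : UniqueDiffOn ℝ (cornerSimplex k) :=
  uniqueDiffOn_convex (convex_cornerSimplex k) (nonempty_interior_cornerSimplex k)

theorem insertNth_mem_cornerSimplex {j : Fin (k + 1)} {t : ℝ} {s : Fin k → ℝ} :
    (j.insertNth t s : Fin (k + 1) → ℝ) ∈ cornerSimplex (k + 1) ↔
      s ∈ cornerSimplex k ∧ t ∈ Icc 0 (1 - ∑ i, s i) := by
  rw [mem_cornerSimplex, mem_cornerSimplex, Fin.forall_iff_succAbove j, Fin.sum_univ_succAbove _ j]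
  simp only [Fin.insertNth_apply_same, Fin.insertNth_apply_succAbove, mem_Icc]
  constructor
  · rintro ⟨⟨h1, h2⟩, h3⟩
    exact ⟨⟨h2, by linarith⟩, h1, by linarith⟩
  · rintro ⟨⟨h1, h2⟩, h3, h4⟩
    exact ⟨⟨h3, h1⟩, by linarith⟩

theorem continuous_insertNth (j : Fin (k + 1)) {X : Type*} [TopologicalSpace X] {f : X → ℝ}
    {g : X → Fin k → ℝ} (hf : Continuous f) (hg : Continuous g) :
    Continuous fun x => (j.insertNth (f x) (g x) : Fin (k + 1) → ℝ) := by
  refine continuous_pi ((Fin.forall_iff_succAbove j).2 ⟨by simpa using hf, fun i => ?_⟩)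
  simpa using (by fun_prop : Continuous fun x => g x i)

theorem hasDerivAt_insertNth (j : Fin (k + 1)) (s : Fin k → ℝ) (t : ℝ) :
    HasDerivAt (fun t => (j.insertNth t s : Fin (k + 1) → ℝ)) (Pi.single j 1) t := by
  refine hasDerivAt_pi.2 ((Fin.forall_iff_succAbove j).2 ⟨?_, fun i => ?_⟩)
  · simpa using hasDerivAt_id' t
  · simpa using hasDerivAt_const t (s i)

/-- Fubini's theorem on the simplex, integrating first over the coordinate of index `j`. -/
theorem setIntegral_cornerSimplex_succ (j : Fin (k + 1)) {g : (Fin (k + 1) → ℝ) → ℝ}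
    (hg : Continuous g) :
    ∫ x in cornerSimplex (k + 1), g x =
      ∫ s in cornerSimplex k, ∫ t in (0)..(1 - ∑ i, s i), g (j.insertNth t s) := by
  let e := MeasurableEquiv.piFinSuccAbove (fun _ : Fin (k + 1) => ℝ) j
  have he : MeasurePreserving e.symm :=
    (volume_preserving_piFinSuccAbove (fun _ : Fin (k + 1) => ℝ) j).symm
  have heq : ∀ t s, e.symm (t, s) = j.insertNth t s := fun t s => rfl
  have hmeas : MeasurableSet (cornerSimplex (k + 1)) :=
    (isCompact_cornerSimplex (k + 1)).isClosed.measurableSet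
  have hmeask : MeasurableSet (cornerSimplex k) :=
    (isCompact_cornerSimplex k).isClosed.measurableSet
  set A := e.symm ⁻¹' cornerSimplex (k + 1) with hA
  have hAm : MeasurableSet A := e.symm.measurable hmeas
  have hint : Integrable (A.indicator fun p => g (e.symm p)) (volume.prod volume) := by
    rw [integrable_indicator_iff hAm]
    exact (he.integrableOn_comp_preimage e.symm.measurableEmbedding).2
      (hg.continuousOn.integrableOn_compact (isCompact_cornerSimplex (k + 1)))
  rw [← he.setIntegral_preimage_emb e.symm.measurableEmbedding, ← integral_indicator hAm,
    Measure.volume_eq_prod, integral_prod_symm _ hint, ← integral_indicator hmeask]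
  refine integral_congr_ae (Filter.Eventually.of_forall fun s => ?_)
  simp only
  by_cases hs : s ∈ cornerSimplex k
  · rw [indicator_of_mem hs, intervalIntegral.integral_of_le
      (sub_nonneg.2 (mem_cornerSimplex.1 hs).2), ← integral_Icc_eq_integral_Ioc,
      ← integral_indicator measurableSet_Icc]
    refine integral_congr_ae (Filter.Eventually.of_forall fun t => ?_)
    have : (t, s) ∈ A ↔ t ∈ Icc 0 (1 - ∑ i, s i) := by
      rw [hA, mem_preimage, heq, insertNth_mem_cornerSimplex]
      simp [hs]
    by_cases ht : t ∈ Icc 0 (1 - ∑ i, s i)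
    · simp only
      rw [indicator_of_mem ht, indicator_of_mem (this.2 ht), heq]
    · simp only
      rw [indicator_of_notMem ht, indicator_of_notMem (fun h => ht (this.1 h))]
  · rw [indicator_of_notMem hs]
    refine (integral_congr_ae (Filter.Eventually.of_forall fun t => ?_)).trans (integral_zero _ _)
    refine indicator_of_notMem (fun h => hs ?_) _
    rw [hA, mem_preimage, heq, insertNth_mem_cornerSimplex] at h
    exact h.1

/-- The integral of a partial derivative over the simplex is a difference of integrals over the face
opposite to the origin, parametrised by the coordinates other than `j`, and the face `s_j = 0`. -/
theorem setIntegral_fderiv_cornerSimplex (j : Fin (k + 1)) {f : (Fin (k + 1) → ℝ) → ℝ}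
    (hf : ContDiff ℝ 1 f) :
    ∫ x in cornerSimplex (k + 1), fderiv ℝ f x (Pi.single j 1) =
      (∫ s in cornerSimplex k, f (j.insertNth (1 - ∑ i, s i) s)) -
        ∫ s in cornerSimplex k, f (j.insertNth 0 s) := by
  have hc : Continuous fun x => fderiv ℝ f x (Pi.single j 1) :=
    (hf.continuous_fderiv (by simp)).clm_apply continuous_const
  rw [setIntegral_cornerSimplex_succ j hc, ← integral_sub]
  · refine integral_congr_ae (Filter.Eventually.of_forall fun s => ?_)
    refine intervalIntegral.integral_eq_sub_of_hasDerivAt (f := fun t => f (j.insertNth t s))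
      (fun t _ => ?_) (Continuous.intervalIntegrable ?_ _ _)
    · exact ((hf.differentiable (by simp)).differentiableAt.hasFDerivAt).comp_hasDerivAt t
        (hasDerivAt_insertNth j s t)
    · exact hc.comp (continuous_insertNth j continuous_id continuous_const)
  · exact (hf.continuous.comp (continuous_insertNth j (by fun_prop) continuous_id)).continuousOn
      |>.integrableOn_compact (isCompact_cornerSimplex k)
  · exact (hf.continuous.comp (continuous_insertNth j (by fun_prop) continuous_id)).continuousOn
      |>.integrableOn_compact (isCompact_cornerSimplex k)

/-- The integral over the face opposite to the origin does not depend on which coordinate is left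
out as a parameter. -/
theorem setIntegral_insertNth_eq_baryCoord (j : Fin (k + 1)) (f : (Fin (k + 1) → ℝ) → ℝ) :
    ∫ s in cornerSimplex k, f (j.insertNth (1 - ∑ i, s i) s) =
      ∫ s in cornerSimplex k, f (baryCoord s) := by
  let L : (Fin k → ℝ) →ₗ[ℝ] (Fin k → ℝ) :=
    { toFun := fun u => Fin.tail (j.insertNth (-∑ i, u i) u : Fin (k + 1) → ℝ)
      map_add' := fun u v => by
        have : (j.insertNth (-∑ i, (u + v) i) (u + v) : Fin (k + 1) → ℝ) =
            j.insertNth (-∑ i, u i) u + j.insertNth (-∑ i, v i) v := by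
          refine funext ((Fin.forall_iff_succAbove j).2 ⟨?_, fun i => ?_⟩)
          · simp [Finset.sum_add_distrib, add_comm]
          · simp
        rw [this]
        rfl
      map_smul' := fun c u => by
        have : (j.insertNth (-∑ i, (c • u) i) (c • u) : Fin (k + 1) → ℝ) =
            c • j.insertNth (-∑ i, u i) u := by
          refine funext ((Fin.forall_iff_succAbove j).2 ⟨?_, fun i => ?_⟩)
          · simp [Finset.mul_sum]
          · simp
        rw [this]
        rfl }
  -- `φ` is the affine permutation of the simplex that relates the two parametrisations.
  let φ : (Fin k → ℝ) → (Fin k → ℝ) := fun u =>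
    Fin.tail (j.insertNth (1 - ∑ i, u i) u : Fin (k + 1) → ℝ)
  have hφL : ∀ u, φ u = L u + φ 0 := fun u => by
    have : (j.insertNth (1 - ∑ i, u i) u : Fin (k + 1) → ℝ) =
        j.insertNth (-∑ i, u i) u + j.insertNth (1 - ∑ i, (0 : Fin k → ℝ) i) 0 := by
      refine funext ((Fin.forall_iff_succAbove j).2 ⟨?_, fun i => ?_⟩)
      · simp; ring
      · simp
    change Fin.tail _ = _
    rw [this]
    rfl
  have hbary : ∀ u, baryCoord (φ u) = j.insertNth (1 - ∑ i, u i) u := fun u => by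
    have hsum : ∑ i, (j.insertNth (1 - ∑ i, u i) u : Fin (k + 1) → ℝ) i = 1 := by
      rw [Fin.sum_univ_succAbove _ j]
      simp
    rw [Fin.sum_univ_succ] at hsum
    refine funext (Fin.forall_fin_succ.2 ⟨?_, fun i => rfl⟩)
    change 1 - ∑ i, φ u i = _
    exact (eq_sub_of_add_eq hsum).symm
  have hφmem : ∀ u, φ u ∈ cornerSimplex k ↔ u ∈ cornerSimplex k := fun u => by
    change (∀ i, 0 ≤ baryCoord (φ u) i) ∧ ∑ i, baryCoord (φ u) i = 1 ↔ _
    rw [sum_baryCoord, hbary, Fin.forall_iff_succAbove j, mem_cornerSimplex]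
    simp [and_comm]
  have hinj : Function.Injective φ := fun u v h => by
    have h1 := congrArg baryCoord h
    rw [hbary, hbary] at h1
    simpa using congrArg j.removeNth h1
  have hsurj : Function.Surjective φ := fun s => by
    refine ⟨j.removeNth (baryCoord s), ?_⟩
    have hsum := sum_baryCoord s
    rw [Fin.sum_univ_succAbove _ j] at hsum
    have hj : 1 - ∑ i, j.removeNth (baryCoord s) i = baryCoord s j :=
      (eq_sub_of_add_eq hsum).symm
    change Fin.tail (j.insertNth (1 - ∑ i, j.removeNth (baryCoord s) i)
      (j.removeNth (baryCoord s)) : Fin (k + 1) → ℝ) = s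
    rw [hj, Fin.insertNth_self_removeNth]
    rfl
  have himage : φ '' cornerSimplex k = cornerSimplex k := by
    ext s
    constructor
    · rintro ⟨u, hu, rfl⟩
      exact (hφmem u).2 hu
    · intro hs
      obtain ⟨u, rfl⟩ := hsurj s
      exact ⟨u, (hφmem u).1 hs, rfl⟩
  have hderiv : ∀ u ∈ cornerSimplex k,
      HasFDerivWithinAt φ (LinearMap.toContinuousLinearMap L) (cornerSimplex k) u := fun u _ => by
    have h : HasFDerivAt (fun u => LinearMap.toContinuousLinearMap L u + φ 0)
        (LinearMap.toContinuousLinearMap L) u :=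
      (LinearMap.toContinuousLinearMap L).hasFDerivAt.add_const _
    have h' : φ = fun u => LinearMap.toContinuousLinearMap L u + φ 0 := funext hφL
    rw [h']
    exact h.hasFDerivWithinAt
  have hmeas : MeasurableSet (cornerSimplex k) :=
    (isCompact_cornerSimplex k).isClosed.measurableSet
  have hchange := fun g : (Fin k → ℝ) → ℝ => integral_image_eq_integral_abs_det_fderiv_smul volume
    hmeas hderiv hinj.injOn g
  rw [himage] at hchange
  -- An affine bijection of a set of positive finite volume onto itself preserves volume.
  have hdet : |(LinearMap.toContinuousLinearMap L).det| = 1 := by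
    have h1 := hchange fun _ => 1
    have hpos : 0 < volume.real (cornerSimplex k) := by
      refine ENNReal.toReal_pos ?_ (isCompact_cornerSimplex k).measure_lt_top.ne
      exact (Measure.measure_pos_of_nonempty_interior volume
        (nonempty_interior_cornerSimplex k)).ne'
    simp only [setIntegral_const, smul_eq_mul, mul_one] at h1
    exact mul_left_cancel₀ hpos.ne' (h1.symm.trans (mul_one _).symm)
  rw [hchange fun s => f (baryCoord s)]
  simp only [hdet, one_smul, hbary]

/-- An alternating `k`-form on the edge vectors `e_i - e_0` of a simplex is the alternating sum of
its values on the facets of the family `e`. Both sides are values of the wedge product of `ℓ` and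
`T`, on `(e_0, e_1 - e_0, …, e_k - e_0)` and on `e`; these agree since the wedge product is
alternating. -/
theorem alternating_sub_eq_sum {V : Type*} [AddCommGroup V] [Module ℝ V] (T : V [⋀^Fin k]→ₗ[ℝ] ℝ)
    (e : Fin (k + 1) → V) (ℓ : V →ₗ[ℝ] ℝ) (hℓ : ∀ i, ℓ (e i) = 1) :
    T (fun i => e i.succ - e 0) = ∑ j : Fin (k + 1), (-1) ^ (j : ℕ) * T (j.removeNth e) := by
  let Ω : V [⋀^Fin (k + 1)]→ₗ[ℝ] ℝ := AlternatingMap.alternatizeUncurryFin (ℓ.smulRight T)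
  have hΩ : ∀ v, Ω v = ∑ j : Fin (k + 1), (-1) ^ (j : ℕ) * (ℓ (v j) * T (j.removeNth v)) := by
    intro v
    simp only [Ω, AlternatingMap.alternatizeUncurryFin_apply]
    refine Finset.sum_congr rfl fun j _ => ?_
    simp
  have h1 : Ω e = ∑ j : Fin (k + 1), (-1) ^ (j : ℕ) * T (j.removeNth e) := by
    simp [hΩ, hℓ]
  -- `w s` is the family `e` with `e 0` subtracted from the members with index in `s`.
  let w : Finset (Fin (k + 1)) → Fin (k + 1) → V := fun s => s.piecewise (fun i => e i - e 0) e
  have h2 : ∀ s : Finset (Fin (k + 1)), 0 ∉ s → Ω (w s) = Ω e := by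
    intro s
    induction s using Finset.induction_on with
    | empty => intro _; simp [w]
    | insert a s ha ih =>
      intro h0
      rw [Finset.mem_insert, not_or] at h0
      have h3 : w (insert a s) = Function.update (w s) a (e a - e 0) := by
        simp only [w]
        rw [Finset.piecewise_insert]
      have h4 : w s a = e a := by simp [w, ha]
      have h5 : w s 0 = e 0 := by simp [w, h0.2]
      rw [h3, AlternatingMap.map_update_sub, ← h4, Function.update_eq_self, ih h0.2,
        sub_eq_self]
      refine Ω.map_eq_zero_of_eq _ (i := a) (j := 0) ?_ (Ne.symm h0.1)
      rw [Function.update_self, Function.update_of_ne h0.1, h5]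
  have h3 : w (Finset.univ.erase 0) = Fin.cons (e 0) fun i => e i.succ - e 0 := by
    refine funext (Fin.forall_fin_succ.2 ⟨by simp [w], fun i => by simp [w]⟩)
  rw [← h1, ← h2 (Finset.univ.erase 0) (by simp), h3, hΩ, Fin.sum_univ_succ]
  simp [hℓ]

/-- Stokes' theorem for a form of degree `k` on the standard simplex of dimension `k + 1`: the first
term on the right is the integral over the face opposite to the origin, with its edges at the
vertex `e_0` as tangent vectors, the others are those over the faces `s_j = 0`. -/
theorem setIntegral_extDeriv_cornerSimplex
    {β : (Fin (k + 1) → ℝ) → (Fin (k + 1) → ℝ) [⋀^Fin k]→L[ℝ] ℝ} (hβ : ContDiff ℝ 1 β) :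
    ∫ x in cornerSimplex (k + 1), extDeriv β x (fun i => Pi.single i 1) =
      (∫ s in cornerSimplex k, β (baryCoord s)
        (fun i => Pi.single i.succ 1 - Pi.single 0 1)) -
      ∑ j : Fin (k + 1), (-1) ^ (j : ℕ) * ∫ s in cornerSimplex k, β (j.insertNth 0 s)
        (fun i => Pi.single (j.succAbove i) 1) := by
  let e : Fin (k + 1) → (Fin (k + 1) → ℝ) := fun i => Pi.single i 1
  have hd : ∀ j : Fin (k + 1), ContDiff ℝ 1 fun x => β x (j.removeNth e) := fun j =>
    (ContinuousAlternatingMap.apply ℝ (Fin (k + 1) → ℝ) ℝ (j.removeNth e)).contDiff.comp hβ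
  have hcompact := isCompact_cornerSimplex (k + 1)
  have h1 : ∀ x, extDeriv β x e =
      ∑ j : Fin (k + 1), (-1) ^ (j : ℕ) * fderiv ℝ (fun x => β x (j.removeNth e)) x (e j) :=
    fun x => by
      rw [extDeriv_apply (hβ.differentiable (by simp)).differentiableAt]
      simp
  have h2 : ∀ y, β y (fun i => Pi.single i.succ 1 - Pi.single 0 1) =
      ∑ j : Fin (k + 1), (-1) ^ (j : ℕ) * β y (j.removeNth e) := fun y =>
    alternating_sub_eq_sum (β y).toAlternatingMap e (∑ i, LinearMap.proj i) fun i => by simp [e]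
  have hbary : Continuous (baryCoord : (Fin k → ℝ) → Fin (k + 1) → ℝ) := by
    refine continuous_pi (Fin.forall_fin_succ.2 ⟨?_, fun i => ?_⟩)
    · simp only [baryCoord, Fin.cons_zero]; fun_prop
    · simp only [baryCoord, Fin.cons_succ]; fun_prop
  change ∫ x in cornerSimplex (k + 1), extDeriv β x e = _
  simp only [h1, h2]
  rw [integral_finsetSum, integral_finsetSum, ← Finset.sum_sub_distrib]
  · refine Finset.sum_congr rfl fun j _ => ?_
    rw [integral_const_mul, integral_const_mul, setIntegral_fderiv_cornerSimplex j (hd j),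
      setIntegral_insertNth_eq_baryCoord j fun y => β y (j.removeNth e), ← mul_sub]
    rfl
  · intro j _
    exact (((hd j).continuous.comp hbary).const_mul _).continuousOn.integrableOn_compact
      (isCompact_cornerSimplex k)
  · intro j _
    refine Continuous.continuousOn ?_ |>.integrableOn_compact hcompact
    exact (((hd j).continuous_fderiv (by simp)).clm_apply continuous_const).const_mul _

end SLSym

/-! ### Integration over smooth simplices -/

namespace SLSym

open MeasureTheory Set

variable {n k : ℕ}

/-- `G` is a smooth map on all of `ℝ^k` that agrees with `σ`, in affine coordinates, on the standard
simplex. -/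
structure SmoothSimplex.IsExtension (σ : SmoothSimplex n k)
    (G : (Fin k → ℝ) → Matrix (Fin n) (Fin n) ℝ) : Prop where
  contDiff : ContDiff ℝ ∞ G
  eq : ∀ s (h : baryCoord s ∈ stdSimplex ℝ (Fin (k + 1))), G s = (σ.toFun ⟨baryCoord s, h⟩).1

theorem contDiff_baryCoord : ContDiff ℝ ∞ (baryCoord : (Fin k → ℝ) → Fin (k + 1) → ℝ) := by
  refine contDiff_pi.2 (Fin.forall_fin_succ.2 ⟨?_, fun i => ?_⟩)
  · simp only [baryCoord, Fin.cons_zero]; fun_prop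
  · simp only [baryCoord, Fin.cons_succ]; fun_prop

theorem SmoothSimplex.exists_isExtension (σ : SmoothSimplex n k) : ∃ G, σ.IsExtension G := by
  obtain ⟨F, hF, h⟩ := σ.smooth
  exact ⟨fun s => F (baryCoord s), (contDiff_matrix_iff.2 hF).comp contDiff_baryCoord,
    fun s hs => h ⟨_, hs⟩⟩

namespace SmoothSimplex.IsExtension

variable {σ : SmoothSimplex n k} {G : (Fin k → ℝ) → Matrix (Fin n) (Fin n) ℝ}

theorem differentiableAt (hG : σ.IsExtension G) (s : Fin k → ℝ) : DifferentiableAt ℝ G s :=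
  (hG.contDiff.differentiable (by simp)).differentiableAt

theorem param_eq (hG : σ.IsExtension G) {s : Fin k → ℝ} (hs : s ∈ cornerSimplex k) :
    σ.param s = G s := by
  have hs' : baryCoord s ∈ stdSimplex ℝ (Fin (k + 1)) := hs
  rw [SmoothSimplex.param, dif_pos hs', hG.eq s hs']

theorem partialDeriv_eq (hG : σ.IsExtension G) {s : Fin k → ℝ} (hs : s ∈ cornerSimplex k)
    (i : Fin k) : σ.partialDeriv s i = fderiv ℝ G s (Pi.single i 1) := by
  ext a b
  change fderivWithin ℝ (fun s' => σ.param s' a b) (cornerSimplex k) s (Pi.single i 1) = _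
  let ε : Matrix (Fin n) (Fin n) ℝ →L[ℝ] ℝ :=
    LinearMap.toContinuousLinearMap (Matrix.entryLinearMap ℝ ℝ a b)
  have h1 : HasFDerivAt (fun s' => G s' a b) (ε.comp (fderiv ℝ G s)) s :=
    ε.hasFDerivAt.comp s (hG.differentiableAt s).hasFDerivAt
  rw [fderivWithin_congr (f₁ := fun s' => σ.param s' a b) (f := fun s' => G s' a b)
    (fun x hx => congrFun (congrFun (hG.param_eq hx) a) b)
    (congrFun (congrFun (hG.param_eq hs) a) b),
    h1.hasFDerivWithinAt.fderivWithin (uniqueDiffOn_cornerSimplex k s hs)]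
  rfl

theorem simplexIntegral_eq (hG : σ.IsExtension G) (η : DiffForm n k) :
    simplexIntegral η σ =
      ∫ s in cornerSimplex k, η.pullback G s fun i => Pi.single i 1 := by
  refine setIntegral_congr_fun (isCompact_cornerSimplex k).isClosed.measurableSet fun s hs => ?_
  rw [hG.param_eq hs, funext (hG.partialDeriv_eq hs)]
  rfl

theorem mem_space (hG : σ.IsExtension G) {s : Fin k → ℝ} (hs : s ∈ cornerSimplex k) :
    ∃ P : Space n, G s = P.1 := ⟨_, hG.eq s hs⟩

theorem fderiv_mem_tangent (hG : σ.IsExtension G) {s : Fin k → ℝ} (hs : s ∈ cornerSimplex k)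
    (P : Space n) (hP : G s = P.1) (u : Fin k → ℝ) : fderiv ℝ G s u ∈ tangent P :=
  SLSym.fderiv_mem_tangent (hG.differentiableAt s) hs (uniqueDiffOn_cornerSimplex k s hs)
    (fun _ hx => hG.mem_space hx) P hP u

end SmoothSimplex.IsExtension

/-! ### Invariance under translation -/

/-- The action `A ↦ g A gᵀ`, as a continuous linear map. -/
def conj (g : Matrix (Fin n) (Fin n) ℝ) :
    Matrix (Fin n) (Fin n) ℝ →L[ℝ] Matrix (Fin n) (Fin n) ℝ :=
  LinearMap.toContinuousLinearMap (LinearMap.mulLeftRight ℝ (g, gᵀ))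

theorem SmoothSimplex.IsExtension.translate {σ : SmoothSimplex n k}
    {G : (Fin k → ℝ) → Matrix (Fin n) (Fin n) ℝ} (hG : σ.IsExtension G)
    (g : Matrix.SpecialLinearGroup (Fin n) ℝ) :
    (σ.translate g).IsExtension fun s => conj g.1 (G s) where
  contDiff := (conj g.1).contDiff.comp hG.contDiff
  eq s hs := by
    rw [hG.eq s hs]
    rfl

theorem DiffForm.IsInvariant.pullback_conj {η : DiffForm n k} (hη : η.IsInvariant)
    {σ : SmoothSimplex n k} {G : (Fin k → ℝ) → Matrix (Fin n) (Fin n) ℝ} (hG : σ.IsExtension G)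
    (g : Matrix.SpecialLinearGroup (Fin n) ℝ) {s : Fin k → ℝ} (hs : s ∈ cornerSimplex k)
    (v : Fin k → Fin k → ℝ) :
    η.pullback (fun s => conj g.1 (G s)) s v = η.pullback G s v := by
  obtain ⟨P, hP⟩ := hG.mem_space hs
  have h1 : fderiv ℝ (fun s => conj g.1 (G s)) s = (conj g.1).comp (fderiv ℝ G s) :=
    ((conj g.1).hasFDerivAt.comp s (hG.differentiableAt s).hasFDerivAt).fderiv
  have h2 := hη.form_conj g.2 P (v := fun i => fderiv ℝ G s (v i))
    fun i => hG.fderiv_mem_tangent hs P hP (v i)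
  rw [← hP] at h2
  refine Eq.trans ?_ h2
  rw [DiffForm.pullback, h1]
  rfl

theorem DiffForm.IsInvariant.simplexIntegral_translate {η : DiffForm n k} (hη : η.IsInvariant)
    (g : Matrix.SpecialLinearGroup (Fin n) ℝ) (σ : SmoothSimplex n k) :
    simplexIntegral η (σ.translate g) = simplexIntegral η σ := by
  obtain ⟨G, hG⟩ := σ.exists_isExtension
  rw [hG.simplexIntegral_eq, (hG.translate g).simplexIntegral_eq]
  exact setIntegral_congr_fun (isCompact_cornerSimplex k).isClosed.measurableSet fun s hs =>
    hη.pullback_conj hG g hs _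

/-! ### Faces and boundaries -/

/-- The inclusion of a face in barycentric coordinates. -/
theorem linearMap_succAbove (i : Fin (k + 2)) (t : Fin (k + 1) → ℝ) :
    FunOnFinite.linearMap ℝ ℝ i.succAbove t = i.insertNth 0 t := by
  refine funext ((Fin.forall_iff_succAbove i).2 ⟨?_, fun j => ?_⟩)
  · rw [FunOnFinite.linearMap_apply_apply]
    simp [Fin.succAbove_ne]
  · rw [FunOnFinite.linearMap_apply_apply]
    simp [Finset.filter_eq']

theorem fderiv_apply_of_affine {X Y : Type*} [NormedAddCommGroup X] [NormedSpace ℝ X]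
    [NormedAddCommGroup Y] [NormedSpace ℝ Y] {f : X → Y} {x v : X} {w : Y}
    (hf : DifferentiableAt ℝ f x) (h : ∀ t : ℝ, f (x + t • v) = f x + t • w) :
    fderiv ℝ f x v = w := by
  rw [← hf.lineDeriv_eq_fderiv]
  refine HasLineDerivAt.lineDeriv ?_
  simp only [HasLineDerivAt, h]
  simpa using! ((hasDerivAt_id (0 : ℝ)).smul_const w).const_add (f x)

theorem DiffForm.pullback_comp (η : DiffForm n k) {X Y : Type*} [NormedAddCommGroup X]
    [NormedSpace ℝ X] [NormedAddCommGroup Y] [NormedSpace ℝ Y]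
    {G : Y → Matrix (Fin n) (Fin n) ℝ} {f : X → Y} {x : X} (hG : DifferentiableAt ℝ G (f x))
    (hf : DifferentiableAt ℝ f x) (v : Fin k → X) :
    η.pullback (fun x => G (f x)) x v = η.pullback G (f x) fun i => fderiv ℝ f x (v i) := by
  have h : fderiv ℝ (fun x => G (f x)) x = (fderiv ℝ G (f x)).comp (fderiv ℝ f x) :=
    fderiv_comp x hG hf
  rw [DiffForm.pullback, h]
  rfl

section Faces

variable {σ : SmoothSimplex n (k + 1)} {G : (Fin (k + 1) → ℝ) → Matrix (Fin n) (Fin n) ℝ}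

/-- `f` expresses the inclusion of the face of index `i` in affine coordinates. -/
theorem SmoothSimplex.IsExtension.face (hG : σ.IsExtension G) (i : Fin (k + 2))
    {f : (Fin k → ℝ) → Fin (k + 1) → ℝ} (hf : ContDiff ℝ ∞ f)
    (h : ∀ s, baryCoord (f s) = i.insertNth 0 (baryCoord s)) :
    (σ.face i).IsExtension fun s => G (f s) where
  contDiff := hG.contDiff.comp hf
  eq s hs := by
    have h1 : (stdSimplex.map i.succAbove ⟨baryCoord s, hs⟩ : stdSimplex ℝ (Fin (k + 2))).1 =
        baryCoord (f s) := by
      rw [h, ← linearMap_succAbove]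
      rfl
    have h2 : baryCoord (f s) ∈ stdSimplex ℝ (Fin (k + 2)) := h1 ▸ Subtype.property _
    have h3 : (⟨baryCoord (f s), h2⟩ : stdSimplex ℝ (Fin (k + 2))) =
      stdSimplex.map i.succAbove ⟨baryCoord s, hs⟩ := Subtype.ext h1.symm
    rw [hG.eq (f s) h2, h3]
    rfl

theorem contDiff_insertNth_zero (j : Fin (k + 1)) :
    ContDiff ℝ ∞ fun s : Fin k → ℝ => (j.insertNth 0 s : Fin (k + 1) → ℝ) := by
  refine contDiff_pi.2 ((Fin.forall_iff_succAbove j).2 ⟨?_, fun i => ?_⟩)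
  · simpa using contDiff_const
  · simpa using contDiff_apply ℝ ℝ i

theorem baryCoord_insertNth_zero (j : Fin (k + 1)) (s : Fin k → ℝ) :
    baryCoord (j.insertNth 0 s : Fin (k + 1) → ℝ) = j.succ.insertNth 0 (baryCoord s) := by
  refine funext ((Fin.forall_iff_succAbove j.succ).2 ⟨?_, Fin.forall_fin_succ.2 ⟨?_, fun i => ?_⟩⟩)
  · simp [baryCoord]
  · simp [baryCoord, Fin.sum_univ_succAbove _ j]
  · simp [baryCoord]

theorem baryCoord_baryCoord (s : Fin k → ℝ) :
    baryCoord (baryCoord s) = (0 : Fin (k + 2)).insertNth 0 (baryCoord s) := by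
  rw [baryCoord, sum_baryCoord, sub_self, Fin.insertNth_zero']

theorem fderiv_insertNth_zero (j : Fin (k + 1)) (s : Fin k → ℝ) (i : Fin k) :
    fderiv ℝ (fun s : Fin k → ℝ => (j.insertNth 0 s : Fin (k + 1) → ℝ)) s (Pi.single i 1) =
      Pi.single (j.succAbove i) 1 := by
  refine fderiv_apply_of_affine ((contDiff_insertNth_zero j).differentiable (by simp)
    |>.differentiableAt) fun t => ?_
  refine funext ((Fin.forall_iff_succAbove j).2 ⟨?_, fun m => ?_⟩)
  · simp
  · simp [Pi.single_apply]

theorem fderiv_baryCoord (s : Fin k → ℝ) (i : Fin k) :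
    fderiv ℝ (baryCoord : (Fin k → ℝ) → Fin (k + 1) → ℝ) s (Pi.single i 1) =
      Pi.single i.succ 1 - Pi.single 0 1 := by
  refine fderiv_apply_of_affine (contDiff_baryCoord.differentiable (by simp)
    |>.differentiableAt) fun t => ?_
  refine funext (Fin.forall_fin_succ.2 ⟨?_, fun m => ?_⟩)
  · simp [baryCoord, Finset.sum_add_distrib, ← Finset.mul_sum]
    ring
  · simp [baryCoord, Pi.single_apply]

/-- The integral of an invariant form over the boundary of a simplex vanishes, by Stokes' theorem
and closedness. -/
theorem DiffForm.IsInvariant.sum_simplexIntegral_face {η : DiffForm n k} (hη : η.IsInvariant)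
    (σ : SmoothSimplex n (k + 1)) :
    ∑ i : Fin (k + 2), (-1 : ℝ) ^ (i : ℕ) * simplexIntegral η (σ.face i) = 0 := by
  obtain ⟨G, hG⟩ := σ.exists_isExtension
  have hstokes := setIntegral_extDeriv_cornerSimplex (η.contDiff_pullback hG.contDiff)
  have hzero : ∫ x in cornerSimplex (k + 1),
      extDeriv (η.pullback G) x (fun i => Pi.single i 1) = 0 := by
    -- The extension of `σ` need not lie in `X_n` near the boundary of the simplex.
    rw [← setIntegral_congr_set (interior_ae_eq_of_null_frontier
      ((convex_cornerSimplex (k + 1)).addHaar_frontier volume))]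
    refine setIntegral_eq_zero_of_forall_eq_zero fun x hx => ?_
    have : ∀ᶠ y in nhds x, ∃ P : Space n, G y = P.1 :=
      Filter.mem_of_superset (mem_interior_iff_mem_nhds.1 hx) fun y hy => hG.mem_space hy
    rw [hη.extDeriv_pullback_eq_zero hG.contDiff this]
    rfl
  have h0 : simplexIntegral η (σ.face 0) = ∫ s in cornerSimplex k,
      η.pullback G (baryCoord s) (fun i => Pi.single i.succ 1 - Pi.single 0 1) := by
    rw [(hG.face 0 contDiff_baryCoord baryCoord_baryCoord).simplexIntegral_eq]
    refine integral_congr_ae (Filter.Eventually.of_forall fun s => ?_)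
    simp only
    rw [η.pullback_comp (hG.differentiableAt _)
      (contDiff_baryCoord.differentiable (by simp)).differentiableAt]
    simp only [fderiv_baryCoord]
  have hsucc : ∀ j : Fin (k + 1), simplexIntegral η (σ.face j.succ) = ∫ s in cornerSimplex k,
      η.pullback G (j.insertNth 0 s) (fun i => Pi.single (j.succAbove i) 1) := fun j => by
    rw [(hG.face j.succ (contDiff_insertNth_zero j)
      (baryCoord_insertNth_zero j)).simplexIntegral_eq]
    refine integral_congr_ae (Filter.Eventually.of_forall fun s => ?_)
    simp only
    rw [η.pullback_comp (f := fun s => (j.insertNth 0 s : Fin (k + 1) → ℝ)) (hG.differentiableAt _)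
      ((contDiff_insertNth_zero j).differentiable (by simp)).differentiableAt]
    simp only [fderiv_insertNth_zero]
  rw [hzero] at hstokes
  rw [Fin.sum_univ_succ, h0]
  simp only [hsucc, Fin.val_succ, pow_succ, Fin.val_zero, pow_zero, one_mul, mul_neg, mul_one,
    neg_mul, Finset.sum_neg_distrib]
  rw [← sub_eq_add_neg]
  exact hstokes.symm

end Faces

theorem DiffForm.IsInvariant.chainIntegral_boundary {η : DiffForm n k} (hη : η.IsInvariant)
    (c : Chain n (k + 1)) : chainIntegral η (boundary n (k + 1) c) = 0 := by
  have h : (chainIntegral η).comp (boundary n (k + 1)) = 0 := by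
    refine Finsupp.lhom_ext' fun σ => LinearMap.ext_ring ?_
    simp only [LinearMap.comp_apply, Finsupp.lsingle_apply, LinearMap.zero_apply, boundary,
      Finsupp.linearCombination_single, one_smul, map_sum, chainIntegral, smul_eq_mul]
    exact hη.sum_simplexIntegral_face σ
  exact LinearMap.congr_fun h c

theorem DiffForm.IsInvariant.chainIntegral_eq_zero_of_mem_boundaries {η : DiffForm n k}
    (hη : η.IsInvariant) {Γ : Subgroup (Matrix.SpecialLinearGroup (Fin n) ℝ)} {c : Chain n k}
    (hc : c ∈ boundaries Γ k) : chainIntegral η c = 0 := by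
  suffices h : boundaries Γ k ≤ LinearMap.ker (chainIntegral η) from h hc
  refine sup_le ?_ (Submodule.span_le.2 ?_)
  · rintro _ ⟨b, rfl⟩
    exact hη.chainIntegral_boundary b
  · rintro _ ⟨γ, -, σ, rfl⟩
    simp [chainIntegral, hη.simplexIntegral_translate]

/-! ### Simplices in `X_{n-1} × ℝ` -/

theorem IsBlock.commute {b : Matrix.SpecialLinearGroup (Fin n) ℝ} (hb : IsBlock b) {l : Fin n}
    (hl : (l : ℕ) + 1 = n) : Commute b.1 (Matrix.single l l 1) := by
  have hiff : ∀ i : Fin n, (i : ℕ) + 1 = n ↔ i = l := fun i => by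
    rw [Fin.ext_iff]; omega
  have h0 := hb.1
  simp only [hiff] at h0
  change b.1 * _ = _ * b.1
  ext i j
  by_cases hi : i = l <;> by_cases hj : j = l
  · subst hi; subst hj; simp
  · subst hi
    simp [hj, h0 i j]
  · subst hj
    simp [hi, h0 i j]
  · simp [hi, hj]

theorem commute_of_mem_blockSubspace {P : Space n} (hP : P ∈ blockSubspace n) {l : Fin n}
    (hl : (l : ℕ) + 1 = n) : Commute P.1 (Matrix.single l l 1) := by
  obtain ⟨b, hb, rfl⟩ := hP
  have h1 := hb.commute hl
  have h2 : Commute b.1ᵀ (Matrix.single l l 1) := by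
    have := congrArg Matrix.transpose h1.eq
    rw [Matrix.transpose_mul, Matrix.transpose_mul, Matrix.transpose_single] at this
    exact this.symm
  exact (h1.mul_left (Commute.one_left _)).mul_left h2

/-- The tangent space of `X_{n-1} × ℝ` at the base point is spanned by the axis and
`blockTangent l`. -/
theorem exists_eq_smul_axis_add {l : Fin n} (hn : 2 ≤ n) {W : Matrix (Fin n) (Fin n) ℝ}
    (hW : W ∈ tangent (basePoint n)) (hc : Commute W (Matrix.single l l 1)) :
    ∃ (c : ℝ) (w : Matrix (Fin n) (Fin n) ℝ), w ∈ blockTangent l ∧ W = c • axis l + w := by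
  obtain ⟨hs, ht⟩ := mem_tangent_basePoint.1 hW
  have hn1 : (1 : ℝ) - n ≠ 0 := by
    have : (2 : ℝ) ≤ n := by exact_mod_cast hn
    linarith
  refine ⟨W l l / (1 - n), W - (W l l / (1 - n)) • axis l, ⟨?_, ?_, fun j => ?_⟩, by simp⟩
  · exact hs.sub ((axis_isSymm l).smul _)
  · simp [ht, axis_trace]
  · by_cases hj : j = l
    · subst hj
      simp [axis, hn1]
    · have h := congrFun (congrFun hc.eq l) j
      have h0 : W l j = 0 := by simpa [hj] using h.symm
      simp [axis, h0, Ne.symm hj]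

/-- An invariant form of degree `dim X_n - rank X_n` integrates to zero over a simplex in
`X_{n-1} × ℝ`: at each point it can be transported to the base point by a block diagonal matrix, and
there `map_span_axis_sup_eq_zero` applies. -/
theorem DiffForm.IsInvariant.simplexIntegral_eq_zero {η : DiffForm n k} (hη : η.IsInvariant)
    (hn : 2 ≤ n) (hk : k = dimX n - rankX n) {σ : SmoothSimplex n k}
    (hσ : ∀ t, σ.toFun t ∈ blockSubspace n) : simplexIntegral η σ = 0 := by
  let l : Fin n := ⟨n - 1, by omega⟩
  have hl : (l : ℕ) + 1 = n := Nat.sub_add_cancel (by omega)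
  have hlt : Module.finrank ℝ (blockTangent l) < k := by
    have h1 := finrank_blockTangent_add_le l hn
    have h2 := rankX_lt (n := n) (by omega)
    omega
  obtain ⟨G, hG⟩ := σ.exists_isExtension
  rw [hG.simplexIntegral_eq]
  refine setIntegral_eq_zero_of_forall_eq_zero fun s hs => ?_
  obtain ⟨b, hb, hbs⟩ := hσ ⟨baryCoord s, hs⟩
  have hG' := hG.translate b⁻¹
  rw [← hη.pullback_conj hG b⁻¹ hs]
  -- `G'` moves the point in question to the base point and keeps the simplex in `X_{n-1} × ℝ`.
  set G' : (Fin k → ℝ) → Matrix (Fin n) (Fin n) ℝ := fun s => conj (b⁻¹).1 (G s) with hG'def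
  have hG's : G' s = (basePoint n).1 := by
    rw [hG'.eq s hs]
    have : (σ.translate b⁻¹).toFun ⟨baryCoord s, hs⟩ = b⁻¹ • σ.toFun ⟨baryCoord s, hs⟩ := rfl
    rw [this, hbs, inv_smul_smul]
  have hinv : Commute (b⁻¹).1 (Matrix.single l l 1) := by
    have h1 : (b⁻¹).1 * b.1 = 1 := congrArg Subtype.val (inv_mul_cancel b)
    have h2 : b.1 * (b⁻¹).1 = 1 := congrArg Subtype.val (mul_inv_cancel b)
    have h3 := (hb.commute hl).eq
    calc (b⁻¹).1 * Matrix.single l l 1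
        = (b⁻¹).1 * (Matrix.single l l 1 * b.1) * (b⁻¹).1 := by
          rw [mul_assoc, mul_assoc, h2, mul_one]
      _ = Matrix.single l l 1 * (b⁻¹).1 := by rw [← h3, ← mul_assoc, h1, one_mul]
  have hinvT : Commute (b⁻¹).1ᵀ (Matrix.single l l 1) := by
    have := congrArg Matrix.transpose hinv.eq
    rw [Matrix.transpose_mul, Matrix.transpose_mul, Matrix.transpose_single] at this
    exact this.symm
  have hcomm : ∀ x ∈ cornerSimplex k, Commute (G' x) (Matrix.single l l 1) := fun x hx => by
    have h1 : Commute (G x) (Matrix.single l l 1) := by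
      rw [hG.eq x hx]
      exact commute_of_mem_blockSubspace (hσ _) hl
    exact (hinv.mul_left h1).mul_left hinvT
  have hWcomm : ∀ u, Commute (fderiv ℝ G' s u) (Matrix.single l l 1) := fun u => by
    change _ * _ = _ * _
    rw [← sub_eq_zero]
    ext i j
    let φ : Matrix (Fin n) (Fin n) ℝ →L[ℝ] ℝ := LinearMap.toContinuousLinearMap
      ((Matrix.entryLinearMap ℝ ℝ i j).comp
        (LinearMap.mulRight ℝ (Matrix.single l l 1) - LinearMap.mulLeft ℝ (Matrix.single l l 1)))
    have hφ : ∀ A : Matrix (Fin n) (Fin n) ℝ, φ A =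
        (A * Matrix.single l l 1 - Matrix.single l l 1 * A : Matrix (Fin n) (Fin n) ℝ) i j :=
      fun A => rfl
    have h := map_fderiv_eq_zero (hG'.differentiableAt s) hs (uniqueDiffOn_cornerSimplex k s hs)
      φ 0 φ.differentiableAt (fun x hx => by rw [hφ, (hcomm x hx).eq, sub_self]; rfl) u
    rw [φ.fderiv, hφ] at h
    exact h
  have hdec := fun i => exists_eq_smul_axis_add hn
    (hG'.fderiv_mem_tangent hs (basePoint n) hG's (Pi.single i 1)) (hWcomm (Pi.single i 1))
  choose c w hw hcw using hdec
  have h1 : η.pullback G' s (fun i => Pi.single i 1) =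
      η.toFun (G' s) (fun i => fderiv ℝ G' s (Pi.single i 1)) := rfl
  rw [h1, hG's]
  simp only [hcw]
  exact map_span_axis_sup_eq_zero l hη.isInfinitesimallyInvariant hlt c w hw

end SLSym

end

theorem mainTheorem4 (n : ℕ) (hn : 2 ≤ n)
    (Γ : Subgroup (Matrix.SpecialLinearGroup (Fin n) ℝ)) (hΓ : SLSym.IsCocompactLattice Γ)
    (k : ℕ) (hk : k = SLSym.dimX n - SLSym.rankX n)
    (η : SLSym.DiffForm n k) (hη : η.IsInvariant)
    (N : Set (SLSym.Space n)) (hN : SLSym.IsGeodesicCopy N)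
    (α : SLSym.Homology Γ k) (hα : SLSym.IsRepresentedBy α N) :
    ∀ z : SLSym.cycles Γ k, SLSym.homologyClass z = α → SLSym.chainIntegral η z.1 = 0 := by
  intro z hz
  obtain ⟨z₀, hz₀N, hz₀⟩ := hα
  obtain ⟨g, rfl⟩ := hN
  have hzero : SLSym.chainIntegral η z₀.1 = 0 := by
    rw [SLSym.chainIntegral, Finsupp.linearCombination_apply]
    refine Finset.sum_eq_zero fun σ hσ => ?_
    beta_reduce
    rw [← hη.simplexIntegral_translate g⁻¹ σ,
      hη.simplexIntegral_eq_zero hn hk (σ := σ.translate g⁻¹) fun t => ?_, smul_zero]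
    obtain ⟨P, hP, hPt⟩ := hz₀N σ hσ t
    change g⁻¹ • σ.toFun t ∈ _
    rw [← hPt, inv_smul_smul]
    exact hP
  have hmem : z.1 - z₀.1 ∈ SLSym.boundaries Γ k := by
    rw [← Submodule.Quotient.eq]
    exact congrArg Subtype.val (hz.trans hz₀.symm)
  have hsub := hη.chainIntegral_eq_zero_of_mem_boundaries hmem
  rwa [map_sub, hzero, sub_zero] at hsub
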